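/- **Notation.** For a prime $p$, $n\ge 1$ and $z\in\mathbb Z_p$ write $e(z/p^n)=\exp(2\pi i z_0/p^n)$, where $z_0\in\mathbb Z$, $z_0\equiv z \bmod p^n$; for $x\in p\mathbb Z_p$ let $\log_p(1+x)=\sum_{m\ge1}(-1)^{m+1}x^m/m$. A *weight* is a Schwartz function $\Phi:\mathbb R\to\mathbb R_{\ge0}$ with support in $[-1,1]$. For a primitive character $\chi$ modulo $p^n$, let $a_0\in\mathbb Z_p^*$ be such that $\chi(1+pt)=e(a_0\log_p(1+pt)/p^n)$ for all $t\in\mathbb Z$. For integers $0<u<p$ and $v$ with $p\nmid v$ put $$F(w)=a_0\log_p\bigl(1+pu^{-1}(2vw+pw^2)\bigr)\qquad(w\in\mathbb Z),$$ with $u^{-1}$ the inverse of $u$ in $\mathbb Z_p$. For $C\in\mathbb R$, $X\ge1$, integers $k_1,k_2,l_1,l_2\ge0$ and $g_1,g_2$, put $\delta_i=p^{k_i+l_i}g_i$, $\Phi_1(y)=\Phi(y)\Phi(y+\delta_1/X)$, $\Phi_2(y)=\Phi_1(y)\Phi_1(y+\delta_2/X)$, and $$T(l_1,g_1)=\sum_{w\in\mathbb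 Z}\Phi_1\Bigl(\frac{w-C}{X}\Bigr)e\Bigl(\frac{F(w+\delta_1)-F(w)}{p^n}\Bigr),$$ $$T(l_1,l_2,g_1,g_2)=\sum_{w\in\mathbb Z}\Phi_2\Bigl(\frac{w-C}{X}\Bigr)e\Bigl(\frac{F(w+\delta_1+\delta_2)-F(w+\delta_1)-F(w+\delta_2)+F(w)}{p^n}\Bigr).$$ For an integer $j\ge2$ and $D>0$ consider the following conditions on $(p,n,\chi,\Phi)$. $(T_1)$ with parameters $(j,D)$: with $s_1=n-(k_1+l_1)$, $$|T(l_1,g_1)|\le D\bigl(Xp^{-s_1/j}+p^{(1-1/j)s_1}\bigr)$$ for all $a_0,u,v,C$ as above, all $k_1\ge6$ with $p^{k_1}\le X$, all $l_1\ge0$ and all $g_1$ with $p\nmid g_1$, $|g_1|<2X/p^{k_1+l_1}$. $(T_2)$ with parameters $(j,D)$: with $s_2=n-(k_1+k_2+l_1+l_2)$, $$|T(l_1,l_2,g_1,g_2)|\le D\bigl(Xp^{-s_2/j}+p^{(1-1/j)s_2}\bigr)$$ for all $a_0,u,v,C$ as above, all $k_1,k_2\ge9$ with $p^{k_1},p^{k_2}\le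 X$, all $l_1,l_2\ge0$ and all $g_1,g_2$ with $p\nmid g_1g_2$, $|g_i|<2X/p^{k_i+l_i}$. **Theorem.** There is an absolute $n_0$ such that for every $K_0>0$ there is $K>0$ depending only on $K_0$, and for all weights $\Psi,\Phi$ and every $L_0>0$ there is $L>0$ depending only on $K_0,L_0,\Psi,\Phi$, with the following property. Let $p>3$ be prime, let $Q(x,y)=ax^2+2bxy+cy^2$ with $a,b,c\in\mathbb Z_p$ and $(c(ac-b^2),p)=1$, let $n\ge n_0$ be a positive integer, $q=p^n$, $\chi$ a primitive character modulo $q$, and let $j_1,j_2\ge2$ be integers. Suppose that $(T_1)$ with parameters $(j_1,p^{K_0}L_0)$ and $(T_2)$ with parameters $(j_2,p^{K_0}L_0)$ hold for $\Phi$ and for $\Psi$. Then for all $A,B\in\mathbb R$ and real $M,N\ge1$ the sum $$S=\sum_{x\in\mathbb Z}\sum_{y\in\mathbb Z}\Psi\Bigl(\frac{x-A}{M}\Bigr)\Phi\Bigl(\frac{y-B}{N}\Bigr)\chi(Q(x,y))$$ satisfies: 1. if $q^{(j_1-1)/(2j_1-1)}\le M,N\le q^{(3j_1-2)/(2(2j_1-1))}$,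 then $$|S|\le p^KL\,\bigl(MN^{1/2}+NM^{1/2}\bigr)q^{(j_1-1)/(2(2j_1-1))};$$ 2. if $q^{(j_2-1)/(3j_2-2)}\le M,N\le q^{2/3}$, then $$|S|\le p^KL\,\bigl(MN^{(7j_2-4)/(2(5j_2-3))}+NM^{(7j_2-4)/(2(5j_2-3))}\bigr)q^{(j_2-1)/(2(5j_2-3))}.$$ Consequently, if $M=N$, then $$|S|\le p^KL\,N^{3/2}q^{(j_1-1)/(2(2j_1-1))}\quad\text{if } q^{(j_1-1)/(2j_1-1)}\le N\le q^{(3j_1-2)/(2(2j_1-1))},$$ $$|S|\le p^KL\,N^{(17j_2-10)/(2(5j_2-3))}q^{(j_2-1)/(2(5j_2-3))}\quad\text{if } q^{(j_2-1)/(3j_2-2)}\le N\le q^{2/3}.$$ -/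

import Mathlib

open scoped SchwartzMap

/-- The `p`-adic power series `x - x^2/2 + x^3/3 - ⋯` of `log_p (1 + x)`. -/
noncomputable def logSeries (p : ℕ) [Fact p.Prime] (x : ℚ_[p]) : ℚ_[p] :=
  ∑' m : ℕ, (-1) ^ m * x ^ (m + 1) / ((m + 1 : ℕ) : ℚ_[p])

theorem norm_logSeries_le (p : ℕ) [Fact p.Prime] (t : ℤ_[p]) :
    ‖logSeries p ((p : ℚ_[p]) * (t : ℚ_[p]))‖ ≤ 1 := by
  unfold logSeries
  refine IsUltrametricDist.norm_tsum_le_of_forall_le_of_nonneg zero_le_one fun m => ?_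
  have hp : 1 < (p : ℝ) := by exact_mod_cast (Fact.out : p.Prime).one_lt
  have hne : ((m + 1 : ℕ) : ℚ_[p]) ≠ 0 := by exact_mod_cast Nat.succ_ne_zero m
  have ht : ‖(t : ℚ_[p])‖ ^ (m + 1) ≤ 1 := pow_le_one₀ (norm_nonneg _) t.2
  have hv : padicValNat p (m + 1) ≤ m + 1 :=
    ((Nat.lt_pow_self (Fact.out : p.Prime).one_lt).le).trans
      (Nat.le_of_dvd (Nat.succ_pos m) pow_padicValNat_dvd)
  rw [norm_div, div_le_one (norm_pos_iff.2 hne), norm_mul, norm_pow, norm_neg, norm_one,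
    one_pow, one_mul, norm_pow, norm_mul, mul_pow, Padic.norm_p,
    Padic.norm_eq_zpow_neg_valuation hne, Padic.valuation_natCast, zpow_neg, zpow_natCast, inv_pow]
  calc ((p : ℝ) ^ (m + 1))⁻¹ * ‖(t : ℚ_[p])‖ ^ (m + 1) ≤ ((p : ℝ) ^ (m + 1))⁻¹ * 1 := by gcongr
    _ = ((p : ℝ) ^ (m + 1))⁻¹ := mul_one _
    _ ≤ ((p : ℝ) ^ padicValNat p (m + 1))⁻¹ := by
      have := pow_le_pow_right₀ hp.le hv
      gcongr

/-- The `p`-adic logarithm `log_p (1 + p t)` for `t ∈ ℤ_p`, as an element of `ℤ_p`. -/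
noncomputable def logOneAdd (p : ℕ) [Fact p.Prime] (t : ℤ_[p]) : ℤ_[p] :=
  ⟨logSeries p ((p : ℚ_[p]) * (t : ℚ_[p])), norm_logSeries_le p t⟩

/-- `e(z / p^n) = exp (2 π i z / p^n)` for `z ∈ ℤ_p`, where `z` is read modulo `p^n`. -/
noncomputable def expMod (p : ℕ) [Fact p.Prime] (n : ℕ) (z : ℤ_[p]) : ℂ :=
  ZMod.stdAddChar (N := p ^ n) (PadicInt.toZModPow n z)

/-- `a₀ ∈ ℤ_p^*` represents `χ` additively: `χ (1 + p t) = e(a₀ log_p (1 + p t) / p^n)` for all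
integers `t`. -/
def RepresentsChar (p : ℕ) [Fact p.Prime] (n : ℕ) (χ : DirichletCharacter ℂ (p ^ n))
    (a₀ : ℤ_[p]) : Prop :=
  IsUnit a₀ ∧ ∀ t : ℤ, χ (((1 + (p : ℤ) * t : ℤ)) : ZMod (p ^ n)) =
    expMod p n (a₀ * logOneAdd p (t : ℤ_[p]))

/-- `F(w) = a₀ log_p (1 + p u⁻¹ g(w))` with `g(w) = 2 v w + p w^2`. Here `u` is a unit of `ℤ_p`
and `u⁻¹` is its inverse in `ℤ_p`. -/
noncomputable def phaseF (p : ℕ) [Fact p.Prime] (a₀ : ℤ_[p]) (u : ℕ) (v : ℤ) (w : ℤ) : ℤ_[p] :=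
  a₀ * logOneAdd p ((u : ℤ_[p]).inv *
    (2 * (v : ℤ_[p]) * (w : ℤ_[p]) + (p : ℤ_[p]) * (w : ℤ_[p]) ^ 2))

/-- The differenced weight `Ω(y) Ω(y + δ)`. -/
def diffWeight (Ω : ℝ → ℝ) (δ : ℝ) (y : ℝ) : ℝ := Ω y * Ω (y + δ)

/-- The sum `T(l₁, g₁)`, obtained by one Weyl shift with `h₁ = p^l₁ g₁`:
`∑_w Φ_{h₁}((w - C) / X) e((F(w + p^k₁ h₁) - F(w)) / p^n)`, where
`Φ_{h₁}(y) = Φ(y) Φ(y + p^k₁ h₁ / X)`. The Taylor expansion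
`F(w + p^k₁ h₁) - F(w) = p^k₁ h₁ (F'(w) + p^k₁ G_{h₁}(w))` shows that the phase is
`g₁ (F'(w) + p^k₁ G_{h₁}(w)) / p^(n - (k₁ + l₁))`. -/
noncomputable def sumT₁ (p : ℕ) [Fact p.Prime] (n : ℕ) (Φ : ℝ → ℝ) (C X : ℝ)
    (a₀ : ℤ_[p]) (u : ℕ) (v : ℤ) (k₁ l₁ : ℕ) (g₁ : ℤ) : ℂ :=
  let d₁ : ℤ := (p : ℤ) ^ k₁ * ((p : ℤ) ^ l₁ * g₁)
  ∑' w : ℤ, (diffWeight Φ ((d₁ : ℝ) / X) (((w : ℝ) - C) / X) : ℂ) *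
    expMod p n (phaseF p a₀ u v (w + d₁) - phaseF p a₀ u v w)

/-- The sum `T(l₁, l₂, g₁, g₂)`, obtained by two Weyl shifts with `hᵢ = p^lᵢ gᵢ`; its weight is
`Φ_{h₁,h₂} = (Φ_{h₁})_{h₂}` and its phase is the second difference of `F` divided by `p^n`,
which by Taylor expansion is
`g₁ g₂ (F''(w) + p^min(k₁,k₂) G_{h₁,h₂}(w)) / p^(n - (k₁ + k₂ + l₁ + l₂))`. -/
noncomputable def sumT₂ (p : ℕ) [Fact p.Prime] (n : ℕ) (Φ : ℝ → ℝ) (C X : ℝ)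
    (a₀ : ℤ_[p]) (u : ℕ) (v : ℤ) (k₁ k₂ l₁ l₂ : ℕ) (g₁ g₂ : ℤ) : ℂ :=
  let d₁ : ℤ := (p : ℤ) ^ k₁ * ((p : ℤ) ^ l₁ * g₁)
  let d₂ : ℤ := (p : ℤ) ^ k₂ * ((p : ℤ) ^ l₂ * g₂)
  ∑' w : ℤ, (diffWeight (diffWeight Φ ((d₁ : ℝ) / X)) ((d₂ : ℝ) / X) (((w : ℝ) - C) / X) : ℂ) *
    expMod p n (phaseF p a₀ u v (w + d₁ + d₂) - phaseF p a₀ u v (w + d₁)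
      - phaseF p a₀ u v (w + d₂) + phaseF p a₀ u v w)

/-- `X / p^(s/j) + p^((1 - 1/j) s)`. -/
noncomputable def completeBound (p : ℕ) (X : ℝ) (j : ℕ) (s : ℤ) : ℝ :=
  X / (p : ℝ) ^ ((s : ℝ) / j) + (p : ℝ) ^ ((1 - 1 / (j : ℝ)) * s)

/-- The first conditional bound for `χ` and the weight `Φ`, with parameter `j` and constant `D`:
`|T(l₁, g₁)| ≤ D (X / p^(s₁/j) + p^((1 - 1/j) s₁))` with `s₁ = n - (k₁ + l₁)`, for all admissible
parameters. The residue `β = u - v^2` is arbitrary subject to `u ≢ 0, β (mod p)`. -/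
def BoundT₁ (p : ℕ) [Fact p.Prime] (n : ℕ) (χ : DirichletCharacter ℂ (p ^ n)) (Φ : ℝ → ℝ)
    (j : ℕ) (D : ℝ) : Prop :=
  ∀ a₀ : ℤ_[p], RepresentsChar p n χ a₀ →
  ∀ u : ℕ, 0 < u → u < p → ∀ v : ℤ, ¬ (p : ℤ) ∣ v →
  ∀ C X : ℝ, ∀ k₁ : ℕ, 6 ≤ k₁ → (p : ℝ) ^ k₁ ≤ X →
  ∀ l₁ : ℕ, ∀ g₁ : ℤ, ¬ (p : ℤ) ∣ g₁ → |(g₁ : ℝ)| < 2 * X / ((p : ℝ) ^ k₁ * (p : ℝ) ^ l₁) →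
    ‖sumT₁ p n Φ C X a₀ u v k₁ l₁ g₁‖ ≤
      D * completeBound p X j ((n : ℤ) - (k₁ + l₁))

/-- The second conditional bound for `χ` and the weight `Φ`, with parameter `j` and constant `D`:
`|T(l₁, l₂, g₁, g₂)| ≤ D (X / p^(s₂/j) + p^((1 - 1/j) s₂))` with
`s₂ = n - (k₁ + k₂ + l₁ + l₂)`, for all admissible parameters. -/
def BoundT₂ (p : ℕ) [Fact p.Prime] (n : ℕ) (χ : DirichletCharacter ℂ (p ^ n)) (Φ : ℝ → ℝ)
    (j : ℕ) (D : ℝ) : Prop :=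
  ∀ a₀ : ℤ_[p], RepresentsChar p n χ a₀ →
  ∀ u : ℕ, 0 < u → u < p → ∀ v : ℤ, ¬ (p : ℤ) ∣ v →
  ∀ C X : ℝ, ∀ k₁ k₂ : ℕ, 9 ≤ min k₁ k₂ → (p : ℝ) ^ k₁ ≤ X → (p : ℝ) ^ k₂ ≤ X →
  ∀ l₁ l₂ : ℕ, ∀ g₁ g₂ : ℤ, ¬ (p : ℤ) ∣ g₁ → ¬ (p : ℤ) ∣ g₂ →
    |(g₁ : ℝ)| < 2 * X / ((p : ℝ) ^ k₁ * (p : ℝ) ^ l₁) →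
    |(g₂ : ℝ)| < 2 * X / ((p : ℝ) ^ k₂ * (p : ℝ) ^ l₂) →
    ‖sumT₂ p n Φ C X a₀ u v k₁ k₂ l₁ l₂ g₁ g₂‖ ≤
      D * completeBound p X j ((n : ℤ) - (k₁ + k₂ + l₁ + l₂))

/-- A weight: a nonnegative Schwartz function with support in `[-1, 1]`. -/
def IsWeight (Φ : 𝓢(ℝ, ℝ)) : Prop :=
  (∀ x, 0 ≤ Φ x) ∧ tsupport (Φ : ℝ → ℝ) ⊆ Set.Icc (-1) 1

/-- `∑_{x ∈ ℤ} ∑_{y ∈ ℤ} Ψ((x - A) / M) Φ((y - B) / N) χ(Q(x, y))` for the form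
`Q(x, y) = a x^2 + 2 b x y + c y^2` over `ℤ_p`, where `χ` is read on `ℤ_p` through reduction
modulo `p^n`. -/
noncomputable def quadSum (p : ℕ) [Fact p.Prime] (n : ℕ) (χ : DirichletCharacter ℂ (p ^ n))
    (a b c : ℤ_[p]) (Ψ Φ : ℝ → ℝ) (A B M N : ℝ) : ℂ :=
  ∑' x : ℤ, ∑' y : ℤ, (Ψ (((x : ℝ) - A) / M) : ℂ) * (Φ (((y : ℝ) - B) / N) : ℂ) *
    χ (PadicInt.toZModPow n (a * (x : ℤ_[p]) ^ 2 + 2 * b * (x : ℤ_[p]) * (y : ℤ_[p])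
      + c * (y : ℤ_[p]) ^ 2))

/-! Write q = p^n. The right-hand sides only grow with j in the ranges considered, so everything
reduces to j = 2. There the estimates say that, up to powers of p, a smooth sum of χ∘Q along a line
of length N is at most N^(1/2) q^(1/6), respectively N^(5/7) q^(1/14). Both line bounds are proved
directly, by p-adic stationary phase and Weyl differencing.

Split the box into residue classes modulo p. A class on which Q is not a unit contributes nothing.
On any other class a shear makes the inner variable run in a direction (e, 1), and the inner sum is
one of χ(ψ(ps)) with ψ(x) = α + 2βx + γx², where α is a unit value of Q, γ = Q(e, 1), and β is the
polar form of the base point and (e, 1). On p ℤ/p^n the logarithmic derivative ψ'/ψ is a polynomial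
G. Up to units, its coefficients of degree 1, 2, 3 are the homogenized Chebyshev polynomials 2β² -
γα, β(4β² - 3γα), 8β⁴ - 8β²γα + γ²α² (`exists_logDer_quadratic`). As functions of the direction
these are binary forms of degree 2, 3, 4. In the direction of the base point itself β = γ = α, and
they equal α², α³, α⁴. Hence they do not vanish identically modulo p, and some e with |e| ≤ 2 makes
the desired coefficient a unit.

If G has a unit linear coefficient, stationary phase gives square-root cancellation
(`norm_phaseSum_le`). A Weyl step (`phaseSum_weyl`) replaces ψ by ψ(x + δ)/ψ(x), whose logarithmic
derivative is δ(G' + δk) (`LogDer.mulDiff`). A unit coefficient of degree i + 1 thus becomes one of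
degree i, as p > 3, while the phase gains a factor δ. One step suffices for a unit quadratic
coefficient, two for a cubic one.

For the first bound one step serves N ≤ q^(2/3), and stationary phase alone serves q^(2/3) ≤ N ≤ q.
For the second, two steps serve N ≤ q^(4/9), and between q^(4/9) and q^(2/3) the one-step bound is
already smaller. Summing over lines (`norm_boxSum_le`) costs the longer side of the box. -/

namespace BoxSum
-- Finitely supported sums over ℤ
open Finset

/-- `g` vanishes outside `[A, A + X]`. -/
def SuppIn {E : Type*} [Zero E] (g : ℤ → E) (A X : ℝ) : Prop :=
  ∀ t, g t ≠ 0 → A ≤ t ∧ (t : ℝ) ≤ A + X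

theorem SuppIn.eq_zero {E : Type*} [Zero E] {g : ℤ → E} {A X : ℝ} (h : SuppIn g A X) {t : ℤ}
    (ht : t ∉ Icc ⌈A⌉ ⌊A + X⌋) : g t = 0 := by
  by_contra hg
  obtain ⟨h1, h2⟩ := h t hg
  exact ht (mem_Icc.2 ⟨Int.ceil_le.2 h1, Int.le_floor.2 h2⟩)

theorem card_Icc_ceil_floor_le {A X : ℝ} (hX : 0 ≤ X) :
    ((Icc ⌈A⌉ ⌊A + X⌋).card : ℝ) ≤ X + 1 := by
  rw [Int.card_Icc]
  have h1 := Int.le_ceil A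
  have h2 := Int.floor_le (A + X)
  rcases le_total 0 (⌊A + X⌋ + 1 - ⌈A⌉) with h | h
  · have : ((⌊A + X⌋ + 1 - ⌈A⌉).toNat : ℝ) = ((⌊A + X⌋ + 1 - ⌈A⌉ : ℤ) : ℝ) := by
      exact_mod_cast Int.toNat_of_nonneg h
    rw [this]; push_cast; linarith
  · rw [Int.toNat_of_nonpos h]; simp; linarith

section Normed
variable {E : Type*} [NormedAddCommGroup E] {g : ℤ → E} {A X : ℝ}

theorem SuppIn.tsum_eq (h : SuppIn g A X) :
    ∑' t, g t = ∑ t ∈ Icc ⌈A⌉ ⌊A + X⌋, g t :=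
  tsum_eq_sum fun _ ht => h.eq_zero ht

theorem SuppIn.summable (h : SuppIn g A X) : Summable g :=
  summable_of_ne_finset_zero (s := Icc ⌈A⌉ ⌊A + X⌋) fun _ ht => h.eq_zero ht

theorem SuppIn.norm (h : SuppIn g A X) : SuppIn (fun t => ‖g t‖) A X :=
  fun t ht => h t (norm_ne_zero_iff.1 ht)

theorem SuppIn.tsum_norm_le (h : SuppIn g A X) (hX : 0 ≤ X) {B : ℝ} (hB : ∀ t, ‖g t‖ ≤ B) :
    ∑' t, ‖g t‖ ≤ (X + 1) * B := by
  have hB0 : 0 ≤ B := (norm_nonneg _).trans (hB 0)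
  rw [h.norm.tsum_eq]
  refine (sum_le_card_nsmul _ _ B fun t _ => hB t).trans ?_
  rw [nsmul_eq_mul]
  exact mul_le_mul_of_nonneg_right (card_Icc_ceil_floor_le hX) hB0

theorem SuppIn.norm_tsum_le (h : SuppIn g A X) (hX : 0 ≤ X) {B : ℝ} (hB : ∀ t, ‖g t‖ ≤ B) :
    ‖∑' t, g t‖ ≤ (X + 1) * B :=
  (norm_tsum_le_tsum_norm h.norm.summable).trans (h.tsum_norm_le hX hB)

end Normed

theorem SuppIn.shift {E : Type*} [Zero E] {g : ℤ → E} {A X : ℝ} (h : SuppIn g A X) (d : ℤ) :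
    SuppIn (fun t => g (t + d)) (A - d) X := by
  intro t ht
  have := h _ ht
  push_cast at this
  constructor <;> linarith

theorem SuppIn.mul_right {g f : ℤ → ℂ} {A X : ℝ} (h : SuppIn g A X) :
    SuppIn (fun t => g t * f t) A X := fun t ht => h t (left_ne_zero_of_mul ht)

theorem tsum_int_add_right {E : Type*} [AddCommMonoid E] [TopologicalSpace E] (g : ℤ → E) (d : ℤ) :
    ∑' t, g (t + d) = ∑' t, g t :=
  (Equiv.addRight d).tsum_eq g

/-! ### Weyl differencing with p-adic shifts -/

/-- The autocorrelation `∑ g(t + d) conj g(t)`. -/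
noncomputable def corr (g : ℤ → ℂ) (d : ℤ) : ℂ := ∑' t, g (t + d) * (starRingEnd ℂ) (g t)

theorem corr_neg (g : ℤ → ℂ) (d : ℤ) : ‖corr g (-d)‖ = ‖corr g d‖ := by
  rw [← Complex.norm_conj (corr g (-d))]
  unfold corr
  rw [Complex.conj_tsum, ← tsum_int_add_right _ d]
  congr 1
  refine tsum_congr fun t => ?_
  simp [mul_comm]

/-- The Weyl–van der Corput inequality with shifts by multiples of `P`. -/
theorem weyl_inequality {g : ℤ → ℂ} {A X : ℝ} (hg : SuppIn g A X) (hX : 1 ≤ X) (H P : ℕ)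
    (hPH : (P : ℝ) * H ≤ X) :
    (H : ℝ) ^ 2 * ‖∑' t, g t‖ ^ 2 ≤
      3 * X * ∑ h ∈ range H, ∑ h' ∈ range H, ‖corr g (P * ((h : ℤ) - h'))‖ := by
  set F : ℤ → ℂ := fun t => ∑ h ∈ range H, g (t + P * h) with hF
  have hsum : ∀ h : ℕ, Summable fun t : ℤ => g (t + P * h) := fun h => (hg.shift _).summable
  have hFsum : ∑' t, F t = H * ∑' t, g t := by
    rw [hF, Summable.tsum_finsetSum (fun h _ => hsum h)]
    simp [tsum_int_add_right g]
  have hFsupp : SuppIn F (A - P * H) (2 * X) := by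
    intro t ht
    obtain ⟨h, hh, hne⟩ := exists_ne_zero_of_sum_ne_zero ht
    have hlt : (h : ℝ) ≤ H := by exact_mod_cast (mem_range.1 hh).le
    have := hg _ hne
    push_cast at this
    have h3 : (P : ℝ) * h ≤ P * H := by gcongr
    have h4 : (0 : ℝ) ≤ P * h := by positivity
    constructor <;> linarith
  set I := Icc ⌈A - P * H⌉ ⌊A - P * H + 2 * X⌋
  -- The averaged function lives on an interval of length X + PH ≤ 2X, which holds at most 2X + 1 ≤
  -- 3X integers.
  have hcard : (I.card : ℝ) ≤ 3 * X :=
    (card_Icc_ceil_floor_le (by linarith)).trans (by linarith)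
  have h1 : ‖∑' t, F t‖ ^ 2 ≤ 3 * X * ∑ t ∈ I, ‖F t‖ ^ 2 := by
    rw [hFsupp.tsum_eq]
    calc ‖∑ t ∈ I, F t‖ ^ 2 ≤ (∑ t ∈ I, ‖F t‖) ^ 2 := by gcongr; exact norm_sum_le _ _
      _ ≤ I.card * ∑ t ∈ I, ‖F t‖ ^ 2 := sq_sum_le_card_mul_sum_sq
      _ ≤ 3 * X * ∑ t ∈ I, ‖F t‖ ^ 2 := by gcongr
  have h2 : ((∑ t ∈ I, ‖F t‖ ^ 2 : ℝ) : ℂ) =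
      ∑ h ∈ range H, ∑ h' ∈ range H, corr g (P * ((h : ℤ) - h')) := by
    have e1 : ((∑ t ∈ I, ‖F t‖ ^ 2 : ℝ) : ℂ) = ∑' t, F t * (starRingEnd ℂ) (F t) := by
      have := (hFsupp.mul_right (f := fun t => (starRingEnd ℂ) (F t))).tsum_eq
      rw [this]
      push_cast
      exact sum_congr rfl fun t _ => (Complex.mul_conj' _).symm
    have e2 : ∀ t, F t * (starRingEnd ℂ) (F t) = ∑ h ∈ range H, ∑ h' ∈ range H,
        g (t + P * h) * (starRingEnd ℂ) (g (t + P * h')) := by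
      intro t
      simp only [hF, map_sum, sum_mul_sum]
    rw [e1]
    simp_rw [e2]
    have hs : ∀ h h' : ℕ, Summable fun t : ℤ =>
        g (t + P * h) * (starRingEnd ℂ) (g (t + P * h')) := fun h h' =>
      ((hg.shift _).mul_right (f := fun t => (starRingEnd ℂ) (g (t + P * h')))).summable
    rw [Summable.tsum_finsetSum (fun h _ => summable_sum fun h' _ => hs h h')]
    refine sum_congr rfl fun h _ => ?_
    rw [Summable.tsum_finsetSum (fun h' _ => hs h h')]
    refine sum_congr rfl fun h' _ => ?_
    rw [corr, ← tsum_int_add_right _ (-((P : ℤ) * h'))]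
    refine tsum_congr fun t => ?_
    congr 2
    · ring
    · congr 1; ring
  have h3 : ∑ t ∈ I, ‖F t‖ ^ 2 ≤
      ∑ h ∈ range H, ∑ h' ∈ range H, ‖corr g (P * ((h : ℤ) - h'))‖ := by
    have : ∑ t ∈ I, ‖F t‖ ^ 2 = ‖((∑ t ∈ I, ‖F t‖ ^ 2 : ℝ) : ℂ)‖ := by
      rw [Complex.norm_real, Real.norm_of_nonneg (by positivity)]
    rw [this, h2]
    exact (norm_sum_le _ _).trans (sum_le_sum fun _ _ => norm_sum_le _ _)
  calc (H : ℝ) ^ 2 * ‖∑' t, g t‖ ^ 2 = ‖∑' t, F t‖ ^ 2 := by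
        rw [hFsum, norm_mul, mul_pow]; simp
    _ ≤ _ := h1.trans (by gcongr)

/-- The sum of `p ^ (v_p(d) / 2)` over `1 ≤ d ≤ H` is `O(H)`. -/
theorem sum_sqrt_padicVal_le (p : ℕ) (hp : p.Prime) (H : ℕ) :
    ∑ d ∈ Ioc 0 H, √((p : ℝ) ^ padicValNat p d) ≤ 4 * H := by
  induction H using Nat.strong_induction_on with
  | _ H ih =>
  rcases Nat.eq_zero_or_pos H with rfl | hH
  · simp
  have hp0 : 0 < p := hp.pos
  have := Fact.mk hp
  rw [← sum_filter_add_sum_filter_not _ (fun d => p ∣ d)]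
  have hA : ∑ d ∈ Ioc 0 H with ¬ p ∣ d, √((p : ℝ) ^ padicValNat p d) ≤ H := by
    calc _ ≤ ∑ d ∈ Ioc 0 H with ¬ p ∣ d, (1 : ℝ) := by
          refine sum_le_sum fun d hd => ?_
          rw [padicValNat.eq_zero_of_not_dvd (mem_filter.1 hd).2]; simp
      _ ≤ ∑ d ∈ Ioc 0 H, (1 : ℝ) :=
          sum_le_sum_of_subset_of_nonneg (filter_subset _ _) (by simp)
      _ = H := by simp
  have hB : ∑ d ∈ Ioc 0 H with p ∣ d, √((p : ℝ) ^ padicValNat p d) =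
      √p * ∑ d ∈ Ioc 0 (H / p), √((p : ℝ) ^ padicValNat p d) := by
    rw [mul_sum]
    symm
    refine sum_bij (fun d _ => p * d) ?_ ?_ ?_ ?_
    · intro d hd
      obtain ⟨h1, h2⟩ := mem_Ioc.1 hd
      refine mem_filter.2 ⟨mem_Ioc.2 ⟨by positivity, ?_⟩, dvd_mul_right _ _⟩
      rw [mul_comm]; exact (Nat.le_div_iff_mul_le hp0).1 h2
    · intro d _ d' _ h
      exact Nat.eq_of_mul_eq_mul_left hp0 h
    · intro d hd
      obtain ⟨h1, c, rfl⟩ := mem_filter.1 hd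
      obtain ⟨h2, h3⟩ := mem_Ioc.1 h1
      refine ⟨c, mem_Ioc.2 ⟨Nat.pos_of_mul_pos_left h2, ?_⟩, rfl⟩
      rw [Nat.le_div_iff_mul_le hp0, mul_comm]; exact h3
    · intro d hd
      have hd0 : d ≠ 0 := (mem_Ioc.1 hd).1.ne'
      rw [padicValNat.mul hp.ne_zero hd0, padicValNat_self, pow_add, pow_one,
        Real.sqrt_mul (by positivity)]
  have hlt : H / p < H := Nat.div_lt_self hH hp.one_lt
  have hdiv : ((H / p : ℕ) : ℝ) ≤ H / p := Nat.cast_div_le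
  have hp2 : (2 : ℝ) ≤ p := by exact_mod_cast hp.two_le
  -- Non-multiples of p contribute at most H, and by induction the multiples contribute at most √p ·
  -- 4H/p = (4/√p)H. The induction closes because 4/√p ≤ 3, already for p = 2.
  have hs : (4 / 3 : ℝ) ≤ √p := Real.le_sqrt_of_sq_le (by nlinarith)
  have hss : √(p : ℝ) * √p = p := Real.mul_self_sqrt (by positivity)
  have : √(p : ℝ) * (4 * ((H / p : ℕ) : ℝ)) ≤ 3 * H := by
    have hs0 : 0 < √(p : ℝ) := by linarith
    calc √(p : ℝ) * (4 * ((H / p : ℕ) : ℝ)) ≤ √(p : ℝ) * (4 * (H / p)) := by gcongr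
      _ = 4 / √p * H := by
        field_simp
        nlinarith
      _ ≤ 3 * H := by
        gcongr
        rw [div_le_iff₀ hs0]; linarith
  rw [hB]
  have := mul_le_mul_of_nonneg_left (ih _ hlt) (Real.sqrt_nonneg (p : ℝ))
  linarith

/-- The Weyl–van der Corput inequality when the correlations at nonzero shifts are at most
`e₂ + e₁ p ^ (v_p / 2)`. -/
theorem weyl_inequality_padic {p : ℕ} (hp : p.Prime) {g : ℤ → ℂ} {A X : ℝ} (hg : SuppIn g A X)
    (hX : 1 ≤ X) (H P : ℕ) (hH : 0 < H) (hPH : (P : ℝ) * H ≤ X) {e₀ e₁ e₂ : ℝ}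
    (he₁ : 0 ≤ e₁) (he₂ : 0 ≤ e₂) (h0 : ‖corr g 0‖ ≤ e₀)
    (hT : ∀ d : ℕ, 0 < d → ‖corr g (P * d)‖ ≤ e₂ + e₁ * √((p : ℝ) ^ padicValNat p d)) :
    ‖∑' t, g t‖ ^ 2 ≤ 3 * X * (e₀ / H + 2 * e₂ + 8 * e₁) := by
  have hHr : (0 : ℝ) < H := by exact_mod_cast hH
  have key : ∀ h ∈ range H, ∑ h' ∈ range H, ‖corr g (P * ((h : ℤ) - h'))‖ ≤
      e₀ + 2 * (e₂ * H + e₁ * (4 * H)) := by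
    intro h hh
    set τ : ℕ → ℝ := fun d => e₂ + e₁ * √((p : ℝ) ^ padicValNat p d) with hτ
    have hτ0 : ∀ d, 0 ≤ τ d := fun d => by positivity
    have hτs : ∑ d ∈ Ioc 0 H, τ d ≤ e₂ * H + e₁ * (4 * H) := by
      simp only [hτ, sum_add_distrib, ← mul_sum]
      have := sum_sqrt_padicVal_le p hp H
      have h2 : ∑ d ∈ Ioc 0 H, e₂ = e₂ * H := by simp [mul_comm]
      rw [h2]; gcongr
    have hlt : h < H := mem_range.1 hh
    -- The norm of a correlation depends only on |h - h'|, so each row is the diagonal term plus two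
    -- partial sums of τ over 1 ≤ d ≤ H.
    have hle : ∀ h' ∈ range H, ‖corr g (P * ((h : ℤ) - h'))‖ ≤
        (if h' = h then e₀ else 0) + ((if h' < h then τ (h - h') else 0) +
          (if h < h' then τ (h' - h) else 0)) := by
      intro h' _
      rcases lt_trichotomy h' h with hl | rfl | hl
      · have := hT (h - h') (by omega)
        rw [Nat.cast_sub hl.le] at this
        simpa [hl.ne, hl, hl.not_gt] using this
      · simpa using h0
      · have := hT (h' - h) (by omega)
        rw [Nat.cast_sub hl.le] at this
        rw [← corr_neg, show -((P : ℤ) * ((h : ℤ) - h')) = P * ((h' : ℤ) - h) by ring]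
        simpa [hl.ne', hl, hl.not_gt] using this
    refine (sum_le_sum hle).trans ?_
    rw [sum_add_distrib, sum_add_distrib, sum_ite_eq' , if_pos hh]
    have hs1 : ∑ h' ∈ range H, (if h' < h then τ (h - h') else 0) ≤ ∑ d ∈ Ioc 0 H, τ d := by
      rw [← sum_filter]
      rw [← sum_image (f := τ) (g := fun h' => h - h')
        (s := (range H).filter fun h' => h' < h)]
      · refine sum_le_sum_of_subset_of_nonneg ?_ fun d _ _ => hτ0 d
        intro d hd
        obtain ⟨h', h1, rfl⟩ := mem_image.1 hd
        have := (mem_filter.1 h1).2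
        exact mem_Ioc.2 ⟨by omega, by omega⟩
      · intro x hx y hy hxy
        have hx := (mem_filter.1 hx).2
        have hy := (mem_filter.1 hy).2
        simp only at hxy
        omega
    have hs2 : ∑ h' ∈ range H, (if h < h' then τ (h' - h) else 0) ≤ ∑ d ∈ Ioc 0 H, τ d := by
      rw [← sum_filter]
      rw [← sum_image (f := τ) (g := fun h' => h' - h)
        (s := (range H).filter fun h' => h < h')]
      · refine sum_le_sum_of_subset_of_nonneg ?_ fun d _ _ => hτ0 d
        intro d hd
        obtain ⟨h', h1, rfl⟩ := mem_image.1 hd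
        have h2 := (mem_filter.1 h1)
        have h3 := mem_range.1 h2.1
        have := h2.2
        exact mem_Ioc.2 ⟨by omega, by omega⟩
      · intro x hx y hy hxy
        have hx := (mem_filter.1 hx).2
        have hy := (mem_filter.1 hy).2
        simp only at hxy
        omega
    linarith
  have h1 := weyl_inequality hg hX H P hPH
  have h2 := sum_le_sum key
  rw [sum_const, card_range, nsmul_eq_mul] at h2
  have h3 : (H : ℝ) ^ 2 * ‖∑' t, g t‖ ^ 2 ≤
      3 * X * (H * (e₀ + 2 * (e₂ * H + e₁ * (4 * H)))) := h1.trans (by gcongr)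
  have h4 : 3 * X * (H * (e₀ + 2 * (e₂ * H + e₁ * (4 * H)))) =
      (H : ℝ) ^ 2 * (3 * X * (e₀ / H + 2 * e₂ + 8 * e₁)) := by
    field_simp
    ring
  rw [h4] at h3
  exact le_of_mul_le_mul_left h3 (by positivity)

/-! ### Discrete smoothness of weights -/

/-- `W` is bounded by `C` and its first and second differences are those of a smooth function
varying at scale `X`. -/
structure IsSmooth (X C : ℝ) (W : ℤ → ℝ) : Prop where
  bound : ∀ t, |W t| ≤ C
  diff : ∀ t h : ℤ, |W (t + h) - W t| ≤ C * |(h : ℝ)| / X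
  diff₂ : ∀ t h : ℤ, |W (t + h) - 2 * W t + W (t - h)| ≤ C * (h : ℝ) ^ 2 / X ^ 2

/-- This is the discrete Leibniz rule. The second difference of a product has four terms, two with a
second difference of one factor and two products of first differences, which accounts for the 4. -/
theorem IsSmooth.mul {X C C' : ℝ} {V W : ℤ → ℝ} (hX : 0 < X) (hV : IsSmooth X C V)
    (hW : IsSmooth X C' W) : IsSmooth X (4 * C * C') (fun t => V t * W t) := by
  have hC : 0 ≤ C := (abs_nonneg _).trans (hV.bound 0)
  have hC' : 0 ≤ C' := (abs_nonneg _).trans (hW.bound 0)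
  refine ⟨fun t => ?_, fun t h => ?_, fun t h => ?_⟩
  · rw [abs_mul]
    have := mul_le_mul (hV.bound t) (hW.bound t) (abs_nonneg _) hC
    nlinarith [mul_nonneg hC hC']
  · have e : V (t + h) * W (t + h) - V t * W t =
        V (t + h) * (W (t + h) - W t) + (V (t + h) - V t) * W t := by ring
    rw [e]
    refine (abs_add_le _ _).trans ?_
    rw [abs_mul, abs_mul]
    have h1 := mul_le_mul (hV.bound (t + h)) (hW.diff t h) (abs_nonneg _) hC
    have h2 := mul_le_mul (hV.diff t h) (hW.bound t) (abs_nonneg _) (by positivity)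
    calc _ ≤ C * (C' * |(h : ℝ)| / X) + C * |(h : ℝ)| / X * C' := add_le_add h1 h2
      _ = 2 * (C * C' * |(h : ℝ)| / X) := by ring
      _ ≤ 4 * (C * C' * |(h : ℝ)| / X) := by
        have : 0 ≤ C * C' * |(h : ℝ)| / X := by positivity
        linarith
      _ = _ := by ring
  · have e : V (t + h) * W (t + h) - 2 * (V t * W t) + V (t - h) * W (t - h) =
        V t * (W (t + h) - 2 * W t + W (t - h)) + (V (t + h) - 2 * V t + V (t - h)) * W t +
        (V (t + h) - V t) * (W (t + h) - W t) + (V (t + -h) - V t) * (W (t + -h) - W t) := by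
      rw [← sub_eq_add_neg]; ring
    rw [e]
    have h1 := mul_le_mul (hV.bound t) (hW.diff₂ t h) (abs_nonneg _) hC
    have h2 := mul_le_mul (hV.diff₂ t h) (hW.bound t) (abs_nonneg _) (by positivity)
    have h3 := mul_le_mul (hV.diff t h) (hW.diff t h) (abs_nonneg _) (by positivity)
    have h4 := mul_le_mul (hV.diff t (-h)) (hW.diff t (-h)) (abs_nonneg _) (by positivity)
    rw [← abs_mul] at h1 h2 h3 h4
    push_cast at h4
    rw [abs_neg] at h4
    have h5 : C * |(h : ℝ)| / X * (C' * |(h : ℝ)| / X) = C * C' * (h : ℝ) ^ 2 / X ^ 2 := by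
      rw [← sq_abs (h : ℝ)]; field_simp
    rw [h5] at h3 h4
    refine (abs_add_le _ _).trans ((add_le_add ((abs_add_le _ _).trans
      (add_le_add (abs_add_le _ _) le_rfl)) le_rfl).trans ?_)
    calc _ ≤ C * (C' * (h : ℝ) ^ 2 / X ^ 2) + C * (h : ℝ) ^ 2 / X ^ 2 * C' +
          C * C' * (h : ℝ) ^ 2 / X ^ 2 + C * C' * (h : ℝ) ^ 2 / X ^ 2 := by linarith
      _ = _ := by ring

theorem IsSmooth.shift {X C : ℝ} {W : ℤ → ℝ} (hW : IsSmooth X C W) (d : ℤ) :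
    IsSmooth X C (fun t => W (t + d)) := by
  refine ⟨fun t => hW.bound _, fun t h => ?_, fun t h => ?_⟩
  · simpa [add_right_comm] using hW.diff (t + d) h
  · simpa [add_right_comm, sub_add_eq_add_sub] using hW.diff₂ (t + d) h

end BoxSum

/-! ### Smooth linear exponential sums -/

namespace BoxSum
open Finset

theorem norm_stdAddChar {D : ℕ} [NeZero D] (j : ZMod D) : ‖ZMod.stdAddChar j‖ = 1 := by
  rw [ZMod.stdAddChar_apply]; exact Circle.norm_coe _

/-- The left side of Jordan's inequality |sin x| ≥ (2/π)|x| on [-π/2, π/2] applies because the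
representative of least absolute value is at most D/2. -/
theorem four_mul_le_norm_one_sub_stdAddChar {D : ℕ} [NeZero D] (j : ZMod D) :
    4 * |(j.valMinAbs : ℝ)| / D ≤ ‖ZMod.stdAddChar j - 1‖ := by
  have hD : (0 : ℝ) < D := by exact_mod_cast NeZero.pos D
  have hj : ZMod.stdAddChar j =
      Complex.exp (Complex.I * ((2 * Real.pi * j.valMinAbs / D : ℝ) : ℂ)) := by
    conv_lhs => rw [← ZMod.coe_valMinAbs j]
    rw [ZMod.stdAddChar_coe]
    congr 1
    push_cast
    ring
  rw [hj, Complex.norm_exp_I_mul_ofReal_sub_one, norm_mul, Real.norm_eq_abs, Real.norm_eq_abs]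
  have habs : |(j.valMinAbs : ℝ)| ≤ D / 2 := by
    have h := j.natAbs_valMinAbs_le
    have h1 : ((j.valMinAbs.natAbs : ℕ) : ℝ) ≤ ((D / 2 : ℕ) : ℝ) := by exact_mod_cast h
    rw [Nat.cast_natAbs, Int.cast_abs] at h1
    exact h1.trans Nat.cast_div_le
  have hx : |2 * Real.pi * (j.valMinAbs : ℝ) / D / 2| = Real.pi * |(j.valMinAbs : ℝ)| / D := by
    rw [show 2 * Real.pi * (j.valMinAbs : ℝ) / D / 2 = Real.pi * (j.valMinAbs : ℝ) / D by ring,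
      abs_div, abs_mul, abs_of_pos Real.pi_pos, abs_of_pos hD]
  have := Real.mul_abs_le_abs_sin (x := 2 * Real.pi * (j.valMinAbs : ℝ) / D / 2) (by
    rw [hx, div_le_iff₀ hD]
    nlinarith [Real.pi_pos])
  rw [hx] at this
  rw [abs_of_pos (by norm_num : (0 : ℝ) < 2)]
  have e : 2 / Real.pi * (Real.pi * |(j.valMinAbs : ℝ)| / D) = 2 * |(j.valMinAbs : ℝ)| / D := by
    have := Real.pi_pos
    field_simp
  rw [e] at this
  linarith [show 4 * |(j.valMinAbs : ℝ)| / D = 2 * (2 * |(j.valMinAbs : ℝ)| / D) by ring]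

/-- Bound for a smooth weighted linear exponential sum. -/
theorem norm_linear_sum_le {D : ℕ} [NeZero D] {A Z C : ℝ} (hZ : 1 ≤ Z) {ω : ℤ → ℝ}
    (hs : SuppIn ω A Z) (hb : ∀ z, |ω z| ≤ C)
    (hd : ∀ z, |ω (z + 1) - 2 * ω z + ω (z - 1)| ≤ C / Z ^ 2) (j : ZMod D) :
    ‖∑' z : ℤ, (ω z : ℂ) * ZMod.stdAddChar (j * (z : ZMod D))‖ ≤
      8 * C * D ^ 2 / Z * (1 / (|(j.valMinAbs : ℝ)| + D / Z) ^ 2) := by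
  set Λ := ∑' z : ℤ, (ω z : ℂ) * ZMod.stdAddChar (j * (z : ZMod D)) with hΛ
  have hD : (0 : ℝ) < D := by exact_mod_cast NeZero.pos D
  have hZ0 : 0 < Z := by linarith
  have hC : 0 ≤ C := (abs_nonneg _).trans (hb 0)
  have hsC : SuppIn (fun z => (ω z : ℂ)) A Z := fun z hz => hs z (Complex.ofReal_ne_zero.1 hz)
  have h1 : ‖Λ‖ ≤ 2 * C * Z := by
    refine ((hsC.mul_right (f := fun z : ℤ => ZMod.stdAddChar (j * (z : ZMod D)))).norm_tsum_le hZ0.le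
      (B := C) fun z => ?_).trans (by nlinarith)
    rw [norm_mul, norm_stdAddChar, mul_one, Complex.norm_real]
    exact hb z
  -- Summation by parts twice: passing to the second difference of ω multiplies the sum by ζ + ζ⁻¹ -
  -- 2, with ζ the value of the character at j. This factor has modulus |ζ - 1|².
  have h2 : ‖ZMod.stdAddChar j - 1‖ ^ 2 * ‖Λ‖ ≤ 4 * C / Z := by
    set φ : ℤ → ℂ := fun z => ((ω (z + 1) - 2 * ω z + ω (z - 1) : ℝ) : ℂ) with hφ
    have hφs : SuppIn φ (A - 1) (Z + 2) := by
      intro z hz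
      by_contra hcon
      have hz' : ∀ y : ℤ, |(y : ℝ) - z| ≤ 1 → ω y = 0 := by
        intro y hy
        by_contra hne
        have := hs y hne
        rw [abs_le] at hy
        exact hcon ⟨by linarith, by linarith⟩
      apply hz
      rw [hφ]
      simp only
      rw [hz' (z + 1) (by push_cast; simp), hz' z (by simp), hz' (z - 1) (by push_cast; simp)]
      simp
    have e : ∑' z, φ z * ZMod.stdAddChar (j * (z : ZMod D)) =
        Λ * (ZMod.stdAddChar j + ZMod.stdAddChar (-j) - 2) := by
      have s0 : Summable fun z : ℤ => (ω z : ℂ) * ZMod.stdAddChar (j * (z : ZMod D)) :=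
        (hsC.mul_right (f := fun z : ℤ => ZMod.stdAddChar (j * (z : ZMod D)))).summable
      have sp : Summable fun z : ℤ => (ω (z + 1) : ℂ) * ZMod.stdAddChar (j * ((z + 1 : ℤ) : ZMod D)) :=
        s0.comp_injective (add_left_injective 1)
      have sm : Summable fun z : ℤ => (ω (z - 1) : ℂ) * ZMod.stdAddChar (j * ((z - 1 : ℤ) : ZMod D)) :=
        s0.comp_injective (sub_left_injective (b := (1 : ℤ)))
      have tp : ∑' z : ℤ, (ω (z + 1) : ℂ) * ZMod.stdAddChar (j * ((z + 1 : ℤ) : ZMod D)) = Λ :=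
        tsum_int_add_right (fun z : ℤ => (ω z : ℂ) * ZMod.stdAddChar (j * (z : ZMod D))) 1
      have tm : ∑' z : ℤ, (ω (z - 1) : ℂ) * ZMod.stdAddChar (j * ((z - 1 : ℤ) : ZMod D)) = Λ :=
        tsum_int_add_right (fun z : ℤ => (ω z : ℂ) * ZMod.stdAddChar (j * (z : ZMod D))) (-1)
      have ev : ∀ z : ℤ, φ z * ZMod.stdAddChar (j * (z : ZMod D)) =
          (ω (z + 1) : ℂ) * ZMod.stdAddChar (j * ((z + 1 : ℤ) : ZMod D)) * ZMod.stdAddChar (-j) +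
          (ω (z - 1) : ℂ) * ZMod.stdAddChar (j * ((z - 1 : ℤ) : ZMod D)) * ZMod.stdAddChar j -
          2 * ((ω z : ℂ) * ZMod.stdAddChar (j * (z : ZMod D))) := by
        intro z
        have e1 : ZMod.stdAddChar (j * ((z + 1 : ℤ) : ZMod D)) * ZMod.stdAddChar (-j) =
            ZMod.stdAddChar (j * (z : ZMod D)) := by
          rw [← AddChar.map_add_eq_mul]; congr 1; push_cast; ring
        have e2 : ZMod.stdAddChar (j * ((z - 1 : ℤ) : ZMod D)) * ZMod.stdAddChar j =
            ZMod.stdAddChar (j * (z : ZMod D)) := by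
          rw [← AddChar.map_add_eq_mul]; congr 1; push_cast; ring
        rw [mul_assoc, e1, mul_assoc, e2, hφ]
        push_cast
        ring
      simp_rw [ev]
      rw [Summable.tsum_sub ((sp.mul_right _).add (sm.mul_right _)) (s0.mul_left _),
        Summable.tsum_add (sp.mul_right _) (sm.mul_right _), tsum_mul_right, tsum_mul_right,
        tsum_mul_left, tp, tm]
      ring
    have e2 : ‖ZMod.stdAddChar j + ZMod.stdAddChar (-j) - 2‖ = ‖ZMod.stdAddChar j - 1‖ ^ 2 := by
      have hm : ZMod.stdAddChar (-j) * ZMod.stdAddChar j = 1 := by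
        rw [← AddChar.map_add_eq_mul]; simp
      have : ZMod.stdAddChar j + ZMod.stdAddChar (-j) - 2 =
          ZMod.stdAddChar (-j) * (ZMod.stdAddChar j - 1) ^ 2 := by
        linear_combination (-(ZMod.stdAddChar j - 2)) * hm
      rw [this, norm_mul, norm_stdAddChar, one_mul, norm_pow]
    have h3 : ‖∑' z, φ z * ZMod.stdAddChar (j * (z : ZMod D))‖ ≤ (Z + 2 + 1) * (C / Z ^ 2) := by
      refine (hφs.mul_right (f := fun z : ℤ => ZMod.stdAddChar (j * (z : ZMod D)))).norm_tsum_le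
        (by linarith) fun z => ?_
      rw [norm_mul, norm_stdAddChar, mul_one, hφ, Complex.norm_real]
      exact hd z
    rw [e, norm_mul, e2, mul_comm] at h3
    refine h3.trans ?_
    calc (Z + 2 + 1) * (C / Z ^ 2) ≤ (4 * Z) * (C / Z ^ 2) := by gcongr; linarith
      _ = 4 * C / Z := by field_simp
  have h3 := four_mul_le_norm_one_sub_stdAddChar j
  set i : ℝ := |(j.valMinAbs : ℝ)|
  have hi : 0 ≤ i := abs_nonneg _
  have h4 : i ^ 2 * ‖Λ‖ ≤ 2 * C * D ^ 2 / Z := by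
    have h5 : (4 * i / D) ^ 2 * ‖Λ‖ ≤ 4 * C / Z := le_trans (by gcongr) h2
    have h6 : i ^ 2 * ‖Λ‖ = D ^ 2 / 16 * ((4 * i / D) ^ 2 * ‖Λ‖) := by field_simp; norm_num
    rw [h6]
    calc _ ≤ D ^ 2 / 16 * (4 * C / Z) := by gcongr
      _ = (1 / 4) * (C * D ^ 2 / Z) := by ring
      _ ≤ 2 * (C * D ^ 2 / Z) := by
        have : 0 ≤ C * D ^ 2 / Z := by positivity
        linarith
      _ = _ := by ring
  have h7 : ((D : ℝ) / Z) ^ 2 * ‖Λ‖ ≤ 2 * C * D ^ 2 / Z := by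
    calc _ ≤ ((D : ℝ) / Z) ^ 2 * (2 * C * Z) := by gcongr
      _ = _ := by field_simp
  -- The bound for i²|Λ| comes from summation by parts, the one for (D/Z)²|Λ| from the trivial
  -- estimate; (x + y)² ≤ 2(x² + y²) merges them.
  have hpos : 0 < (i + D / Z) ^ 2 := by positivity
  rw [mul_one_div, le_div_iff₀ hpos]
  calc ‖Λ‖ * (i + D / Z) ^ 2 ≤ ‖Λ‖ * (2 * (i ^ 2 + (D / Z) ^ 2)) := by
        gcongr
        nlinarith [sq_nonneg (i - D / Z)]
    _ = 2 * (i ^ 2 * ‖Λ‖ + (D / Z) ^ 2 * ‖Λ‖) := by ring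
    _ ≤ 2 * (2 * C * D ^ 2 / Z + 2 * C * D ^ 2 / Z) := by gcongr
    _ = _ := by ring

theorem sum_Ioc_inv_sq_le {ρ : ℝ} (hρ : 0 < ρ) (N : ℕ) :
    ∑ i ∈ Ioc 0 N, 1 / ((i : ℝ) + ρ) ^ 2 ≤ 1 / ρ - 1 / (N + ρ) := by
  induction N with
  | zero => simp
  | succ N ih =>
    rw [← insert_Ioc_right_eq_Ioc_add_one (Nat.zero_le N), sum_insert (by simp)]
    -- Telescoping, from 1/t² ≤ 1/(t - 1) - 1/t.
    have : 1 / (((N + 1 : ℕ) : ℝ) + ρ) ^ 2 ≤ 1 / (N + ρ) - 1 / (((N + 1 : ℕ) : ℝ) + ρ) := by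
      push_cast
      have h1 : 0 < (N : ℝ) + ρ := by positivity
      rw [div_sub_div _ _ (by positivity) (by positivity), div_le_div_iff₀ (by positivity)
        (by positivity)]
      nlinarith
    linarith

theorem sum_valMinAbs_le {D : ℕ} [NeZero D] {ρ : ℝ} (hρ : 0 < ρ) :
    ∑ j : ZMod D, 1 / (|(j.valMinAbs : ℝ)| + ρ) ^ 2 ≤ 1 / ρ ^ 2 + 2 / ρ := by
  have h1 : ∀ j : ZMod D, 1 / (|(j.valMinAbs : ℝ)| + ρ) ^ 2 =
      (fun i : ℤ => 1 / (|(i : ℝ)| + ρ) ^ 2) j.valMinAbs := fun _ => rfl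
  rw [sum_congr rfl fun j _ => h1 j, ← sum_image (s := univ) (g := fun j : ZMod D => j.valMinAbs)
    (f := fun i : ℤ => 1 / (|(i : ℝ)| + ρ) ^ 2) (fun x _ y _ h => ZMod.injective_valMinAbs h)]
  have hsub : univ.image (fun j : ZMod D => j.valMinAbs) ⊆
      {0} ∪ ((Ioc 0 D).image (fun i : ℕ => (i : ℤ)) ∪ (Ioc 0 D).image (fun i : ℕ => -(i : ℤ))) := by
    intro i hi
    obtain ⟨j, _, rfl⟩ := mem_image.1 hi
    have h := j.natAbs_valMinAbs_le
    have hD2 : D / 2 ≤ D := Nat.div_le_self _ _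
    simp only [mem_union, mem_singleton, mem_image, mem_Ioc]
    rcases lt_trichotomy j.valMinAbs 0 with h0 | h0 | h0
    · exact Or.inr (Or.inr ⟨j.valMinAbs.natAbs, ⟨by omega, by omega⟩, by omega⟩)
    · exact Or.inl h0
    · exact Or.inr (Or.inl ⟨j.valMinAbs.natAbs, ⟨by omega, by omega⟩, by omega⟩)
  refine (sum_le_sum_of_subset_of_nonneg hsub fun _ _ _ => by positivity).trans ?_
  have hu : ∀ (s t : Finset ℤ), ∑ i ∈ s ∪ t, 1 / (|(i : ℝ)| + ρ) ^ 2 ≤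
      ∑ i ∈ s, 1 / (|(i : ℝ)| + ρ) ^ 2 + ∑ i ∈ t, 1 / (|(i : ℝ)| + ρ) ^ 2 := by
    intro s t
    rw [← sum_union_inter]
    exact le_add_of_nonneg_right (sum_nonneg fun _ _ => by positivity)
  refine (hu _ _).trans ((add_le_add le_rfl (hu _ _)).trans ?_)
  rw [sum_image (by intro x _ y _ h; simpa using h), sum_image (by intro x _ y _ h; simpa using h)]
  have h2 := sum_Ioc_inv_sq_le hρ D
  have h3 : 0 ≤ 1 / ((D : ℝ) + ρ) := by positivity
  simp only [sum_singleton, Int.cast_zero, abs_zero, zero_add, Int.cast_neg, abs_neg,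
    Int.cast_natCast, Nat.abs_cast]
  have : 2 / ρ = 1 / ρ + 1 / ρ := by ring
  linarith

/-- Sum of the bound for linear sums over all frequencies. -/
theorem sum_linear_bound_le {D : ℕ} [NeZero D] {Z C : ℝ} (hZ : 1 ≤ Z) (hC : 0 ≤ C) :
    ∑ j : ZMod D, 8 * C * D ^ 2 / Z * (1 / (|(j.valMinAbs : ℝ)| + D / Z) ^ 2) ≤
      8 * C * (Z + 2 * D) := by
  have hD : (0 : ℝ) < D := by exact_mod_cast NeZero.pos D
  have hZ0 : 0 < Z := by linarith
  rw [← mul_sum]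
  calc _ ≤ 8 * C * D ^ 2 / Z * (1 / ((D : ℝ) / Z) ^ 2 + 2 / ((D : ℝ) / Z)) := by
        gcongr
        exact sum_valMinAbs_le (by positivity)
    _ = _ := by field_simp

end BoxSum

/-! ### Polynomial logarithmic derivatives on p ℤ/p^n -/

namespace BoxSum
open Finset Polynomial

section Reduction
variable {p n : ℕ} [hp : Fact p.Prime]

/-- Reduction `ℤ / p ^ n → ℤ / p`. -/
def red (hn : n ≠ 0) : ZMod (p ^ n) →+* ZMod p := ZMod.castHom (dvd_pow_self p hn) (ZMod p)

theorem red_eq_zero_iff (hn : n ≠ 0) (x : ZMod (p ^ n)) : red hn x = 0 ↔ (p : ZMod (p ^ n)) ∣ x := by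
  have : NeZero (p ^ n) := ⟨pow_ne_zero _ hp.out.ne_zero⟩
  constructor
  · intro h
    rw [← ZMod.natCast_zmod_val x, map_natCast, ZMod.natCast_eq_zero_iff] at h
    obtain ⟨c, hc⟩ := h
    exact ⟨c, by rw [← ZMod.natCast_zmod_val x, hc]; push_cast; ring⟩
  · rintro ⟨c, rfl⟩
    simp

theorem isUnit_iff_red_ne_zero (hn : n ≠ 0) (x : ZMod (p ^ n)) : IsUnit x ↔ red hn x ≠ 0 := by
  have : NeZero (p ^ n) := ⟨pow_ne_zero _ hp.out.ne_zero⟩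
  rw [← ZMod.natCast_zmod_val x, map_natCast, ZMod.isUnit_iff_coprime, Ne, ZMod.natCast_eq_zero_iff,
    Nat.coprime_pow_right_iff (Nat.pos_of_ne_zero hn), Nat.coprime_comm,
    hp.out.coprime_iff_not_dvd]

theorem pow_eq_zero_of_dvd {x : ZMod (p ^ n)} (hx : (p : ZMod (p ^ n)) ∣ x) : x ^ n = 0 := by
  obtain ⟨c, rfl⟩ := hx
  rw [mul_pow, ← Nat.cast_pow, ZMod.natCast_self, zero_mul]

end Reduction

/-- A divided difference of a polynomial. -/
theorem exists_divided_difference {R : Type*} [CommRing R] (G : R[X]) (δ : R) :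
    ∃ k : R[X], ∀ x, G.eval (x + δ) = G.eval x + δ * (derivative G + C δ * k).eval x := by
  -- Expanding over `R[X]` at the generic point X makes the second-order remainder a polynomial in
  -- the base point.
  obtain ⟨k, hk⟩ := (G.map C).binomExpansion X (C δ)
  refine ⟨k, fun x => ?_⟩
  have h := congrArg (eval x) hk
  rw [derivative_map, eval_map, eval_map, eval_map, eval₂_C_X, eval₂_C_X] at h
  change eval x (G.comp (X + C δ)) = _ at h
  rw [eval_comp] at h
  simp only [eval_add, eval_X, eval_C, eval_mul, eval_pow] at h ⊢
  rw [h]; ring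

section LogDer
variable {p n : ℕ} [hp : Fact p.Prime]

/-- On `p ℤ / p ^ n` the unit-valued function `ψ` satisfies
`ψ (x + ε) = ψ x (1 + π ε (G x + ε H_ε x))` with polynomials `G`, `H_ε`. -/
structure LogDer (ψ : ZMod (p ^ n) → ZMod (p ^ n)) (π : ZMod (p ^ n)) (G : (ZMod (p ^ n))[X]) :
    Prop where
  isUnit : ∀ x, (p : ZMod (p ^ n)) ∣ x → IsUnit (ψ x)
  expand : ∀ ε, (p : ZMod (p ^ n)) ∣ ε → ∃ H : (ZMod (p ^ n))[X], ∀ x, (p : ZMod (p ^ n)) ∣ x →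
    ψ (x + ε) = ψ x * (1 + π * ε * (G.eval x + ε * H.eval x))

theorem mul_geom_sum_of_dvd {y : ZMod (p ^ n)} (hy : (p : ZMod (p ^ n)) ∣ y) :
    (1 - y) * ∑ i ∈ range n, y ^ i = 1 := by
  rw [mul_neg_geom_sum, pow_eq_zero_of_dvd hy, sub_zero]

theorem zmod_inv_eq_of_mul_eq_one {m : ℕ} {x y : ZMod m} (h : x * y = 1) : x⁻¹ = y :=
  left_inv_eq_right_inv (ZMod.inv_mul_of_unit x (IsUnit.of_mul_eq_one _ h)) h

/-- The multiplicative difference of `ψ` with shift `δ`. -/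
def mulDiff (ψ : ZMod (p ^ n) → ZMod (p ^ n)) (δ : ZMod (p ^ n)) : ZMod (p ^ n) → ZMod (p ^ n) :=
  fun x => ψ (x + δ) * (ψ x)⁻¹

/-- The logarithmic derivative of ψ(x + δ)/ψ(x) is π(G(x + δ) - G(x)), and the divided difference of
G extracts the factor δ. -/
theorem LogDer.mulDiff {ψ : ZMod (p ^ n) → ZMod (p ^ n)} {π : ZMod (p ^ n)} {G : (ZMod (p ^ n))[X]}
    (h : LogDer ψ π G) {δ : ZMod (p ^ n)} (hδ : (p : ZMod (p ^ n)) ∣ δ) :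
    ∃ k, LogDer (mulDiff ψ δ) (π * δ) (derivative G + C δ * k) := by
  obtain ⟨k, hk⟩ := exists_divided_difference G δ
  have hinv : ∀ x, (p : ZMod (p ^ n)) ∣ x → ψ x * (ψ x)⁻¹ = 1 := fun x hx =>
    ZMod.mul_inv_of_unit _ (h.isUnit x hx)
  refine ⟨k, ⟨fun x hx => ?_, fun ε hε => ?_⟩⟩
  · exact (h.isUnit _ (dvd_add hx hδ)).mul (IsUnit.of_mul_eq_one _ ((mul_comm _ _).trans (hinv x hx)))
  obtain ⟨H, hH⟩ := h.expand ε hε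
  obtain ⟨l, hl⟩ := exists_divided_difference H δ
  set D := derivative G + C δ * k
  set DH := derivative H + C δ * l
  set K := G + C ε * H with hK
  set J : (ZMod (p ^ n))[X] := ∑ i ∈ range n, (-(C (π * ε) * K)) ^ i with hJ
  -- J inverts 1 + πεK. The quotient of 1 + πεK(x + δ) by 1 + πεK(x) is 1 + πεδ(D + ε DH)J;
  -- substituting J = 1 - πεKJ in the D term leaves D plus ε times this witness.
  refine ⟨DH * J - C π * D * K * J, fun x hx => ?_⟩
  have e1 := hH x hx
  have e2 := hH (x + δ) (dvd_add hx hδ)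
  rw [hk x, hl x] at e2
  set u := ψ x
  set i := (ψ x)⁻¹
  have hui : u * i = 1 := hinv x hx
  have hJE : (1 + π * ε * K.eval x) * J.eval x = 1 := by
    have : (p : ZMod (p ^ n)) ∣ -(π * ε * K.eval x) :=
      (dvd_neg).2 ((hε.mul_left π).mul_right _)
    have := mul_geom_sum_of_dvd this
    rw [sub_neg_eq_add] at this
    rw [hJ, eval_finsetSum]
    simpa using this
  have hKx : K.eval x = G.eval x + ε * H.eval x := by simp [hK]
  rw [hKx] at hJE
  have hinvE : (ψ (x + ε))⁻¹ = i * J.eval x := by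
    apply zmod_inv_eq_of_mul_eq_one
    rw [e1]
    linear_combination (1 + π * ε * (eval x G + ε * eval x H)) * eval x J * hui + hJE
  simp only [BoxSum.mulDiff]
  rw [hinvE, show x + ε + δ = x + δ + ε by ring, e2]
  simp only [eval_sub, eval_mul, eval_C, hKx]
  linear_combination ψ (x + δ) * i * (1 + π * ε * δ * eval x D) * hJE

/-- The geometric series for the inverse stops after n terms, since x^n = 0 for p ∣ x. As
polynomials the product with the quadratic is 1 only modulo X^n; n ≥ 4 is what fixes the
coefficients up to degree 3. -/
theorem exists_inverse_quadratic (hn : 4 ≤ n) {α : ZMod (p ^ n)} (hα : IsUnit α)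
    (β c : ZMod (p ^ n)) : ∃ I : (ZMod (p ^ n))[X],
      (∀ x, (p : ZMod (p ^ n)) ∣ x → (α + 2 * β * x + c * x ^ 2) * I.eval x = 1) ∧
      α * I.coeff 0 = 1 ∧ α * I.coeff 1 + 2 * β * I.coeff 0 = 0 ∧
      α * I.coeff 2 + 2 * β * I.coeff 1 + c * I.coeff 0 = 0 ∧
      α * I.coeff 3 + 2 * β * I.coeff 2 + c * I.coeff 1 = 0 := by
  obtain ⟨a, ha⟩ := hα.exists_right_inv
  set Y' : (ZMod (p ^ n))[X] := -(C (a * (2 * β)) + C (a * c) * X) with hY'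
  set I : (ZMod (p ^ n))[X] := C a * ∑ i ∈ range n, (X * Y') ^ i with hI
  have hmul : (C α + X * (C (2 * β) + X * C c)) * I = 1 - X ^ n * Y' ^ n := by
    have e : C α + X * (C (2 * β) + X * C c) = C α * (1 - X * Y') := by
      have : C α * C a = (1 : (ZMod (p ^ n))[X]) := by rw [← C_mul, ha, C_1]
      rw [hY']
      simp only [C_mul] at this ⊢
      linear_combination -(X * (C 2 * C β + X * C c)) * this
    have ha' : C α * C a = (1 : (ZMod (p ^ n))[X]) := by rw [← C_mul, ha, C_1]
    rw [e, hI, ← mul_pow, ← mul_neg_geom_sum]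
    linear_combination ((1 - X * Y') * ∑ i ∈ range n, (X * Y') ^ i) * ha'
  have hco : ∀ i, i < 4 → ((C α + X * (C (2 * β) + X * C c)) * I).coeff i =
      (1 : (ZMod (p ^ n))[X]).coeff i := by
    intro i hi
    rw [hmul, coeff_sub, coeff_X_pow_mul', if_neg (by omega), sub_zero]
  have e : (C α + X * (C (2 * β) + X * C c)) * I =
      C α * I + X * (C (2 * β) * I) + X * (X * (C c * I)) := by ring
  rw [e] at hco
  refine ⟨I, fun x hx => ?_, ?_, ?_, ?_, ?_⟩
  · have h1 := congrArg (eval x) hmul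
    simp only [eval_mul, eval_add, eval_C, eval_X, eval_sub, eval_one, eval_pow,
      pow_eq_zero_of_dvd hx, zero_mul, sub_zero] at h1
    rw [← h1]; ring
  · simpa using hco 0 (by norm_num)
  · simpa [coeff_X_mul, coeff_one, -map_mul] using hco 1 (by norm_num)
  · simpa [coeff_X_mul, coeff_one, -map_mul] using hco 2 (by norm_num)
  · simpa [coeff_X_mul, coeff_one, -map_mul] using hco 3 (by norm_num)

/-- G is (2β + 2cx) times the polynomial inverse of the quadratic. The recurrence for the
coefficients of the inverse produces the homogenized Chebyshev polynomials of degrees 2, 3, 4. -/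
theorem exists_logDer_quadratic (hn : 4 ≤ n) {α : ZMod (p ^ n)} (hα : IsUnit α)
    (β c : ZMod (p ^ n)) : ∃ G : (ZMod (p ^ n))[X],
      LogDer (fun x => α + 2 * β * x + c * x ^ 2) 1 G ∧
      α ^ 2 * G.coeff 1 = -2 * (2 * β ^ 2 - c * α) ∧
      α ^ 3 * G.coeff 2 = 2 * (β * (4 * β ^ 2 - 3 * c * α)) ∧
      α ^ 4 * G.coeff 3 = -2 * (8 * β ^ 4 - 8 * β ^ 2 * c * α + c ^ 2 * α ^ 2) := by
  obtain ⟨I, hI, h0, h1, h2, h3⟩ := exists_inverse_quadratic hn hα β c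
  have hG : ∀ i, (C (2 * β) * I + X * (C (2 * c) * I)).coeff (i + 1) =
      2 * β * I.coeff (i + 1) + 2 * c * I.coeff i := by
    intro i
    rw [coeff_add, coeff_X_mul, coeff_C_mul, coeff_C_mul]
  refine ⟨C (2 * β) * I + X * (C (2 * c) * I), ⟨fun x hx => IsUnit.of_mul_eq_one _ (hI x hx),
    fun ε hε => ⟨C c * I, fun x hx => ?_⟩⟩, ?_, ?_, ?_⟩
  · have := hI x hx
    simp only [eval_add, eval_mul, eval_C, eval_X]
    linear_combination -(ε * (2 * β + 2 * c * x + c * ε)) * this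
  · rw [hG 0]
    linear_combination (2 * c * α - 4 * β ^ 2) * h0 + 2 * β * α * h1
  · rw [hG 1]
    linear_combination 2 * β * α ^ 2 * h2 + (2 * c * α ^ 2 - 4 * β ^ 2 * α) * h1 +
      (-6 * β * c * α + 8 * β ^ 3) * h0
  · rw [hG 2]
    linear_combination 2 * β * α ^ 3 * h3 + (2 * c * α ^ 3 - 4 * β ^ 2 * α ^ 2) * h2 +
      (-6 * β * c * α ^ 2 + 8 * β ^ 3 * α) * h1 +
      (-2 * c ^ 2 * α ^ 2 + 16 * β ^ 2 * c * α - 16 * β ^ 4) * h0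

/-- If the linear coefficient of `G` is a unit, then `G x - G y` is a unit multiple of `x - y`. -/
theorem exists_isUnit_eval_sub (hn : n ≠ 0) {G : (ZMod (p ^ n))[X]} (hG : IsUnit (G.coeff 1))
    {x y : ZMod (p ^ n)} (hx : (p : ZMod (p ^ n)) ∣ x) (hy : (p : ZMod (p ^ n)) ∣ y) :
    ∃ u, IsUnit u ∧ G.eval x - G.eval y = (x - y) * u := by
  obtain ⟨k, hk⟩ := G.binomExpansion y (x - y)
  obtain ⟨l, hl⟩ := (derivative G).evalSubFactor y 0
  have h0 : (derivative G).eval 0 = G.coeff 1 := by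
    rw [← coeff_zero_eq_eval_zero, coeff_derivative]; simp
  rw [add_sub_cancel] at hk
  -- Modulo p the last two terms vanish, so this factor reduces to the linear coefficient of G.
  refine ⟨G.coeff 1 + l * y + k * (x - y), ?_, ?_⟩
  · rw [isUnit_iff_red_ne_zero hn] at hG ⊢
    rw [map_add, map_add, map_mul, map_mul, map_sub, (red_eq_zero_iff hn x).2 hx,
      (red_eq_zero_iff hn y).2 hy]
    simpa using hG
  · rw [hk]
    rw [h0] at hl
    linear_combination (x - y) * hl

end LogDer

/-! ### Directions with a nonvanishing coefficient -/

section Direction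
variable {F : Type*} [Field F] (h2 : (2 : F) ≠ 0) (h3 : (3 : F) ≠ 0) (a b c x y : F)
include h2

/-- The expression is a binary quadratic form in the direction, taken at (e, 1). Its value at (x, y)
is 2α² - α² = α² ≠ 0. Interpolation from e = 0, 1, -1 would give 2α² = 0 if all three values
vanished. The cubic and quartic analogues use one more node each, with multipliers 6 and 24. -/
theorem exists_direction₀ (hα : x * (a * x + b * y) + y * (b * x + c * y) ≠ 0) :
    ∃ e : ℤ, |e| ≤ 2 ∧ 2 * (e * (a * x + b * y) + (b * x + c * y)) ^ 2 -
      (a * e ^ 2 + 2 * b * e + c) * (x * (a * x + b * y) + y * (b * x + c * y)) ≠ 0 := by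
  set α := x * (a * x + b * y) + y * (b * x + c * y) with hαd
  by_contra! hcon
  have e0 := hcon 0 (by norm_num)
  have e1 := hcon 1 (by norm_num)
  have e2 := hcon (-1) (by norm_num)
  push_cast at e0 e1 e2
  set U := a * x + b * y with hU
  set V := b * x + c * y with hV
  have hQ : a * x ^ 2 + 2 * b * x * y + c * y ^ 2 = α := by rw [hαd, hU, hV]; ring
  have : 2 * α ^ 2 = 0 := by
    have hF : 2 * (x * U + y * V) ^ 2 - (a * x ^ 2 + 2 * b * x * y + c * y ^ 2) * α = α ^ 2 := by
      rw [hQ, ← hαd]; ring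
    rw [← hF]
    linear_combination 2 * (y ^ 2 - x ^ 2) * e0 + x * (x + y) * e1 + x * (x - y) * e2
  exact (mul_ne_zero h2 (pow_ne_zero 2 hα)) this

include h3

theorem exists_direction₁ (hα : x * (a * x + b * y) + y * (b * x + c * y) ≠ 0) :
    ∃ e : ℤ, |e| ≤ 2 ∧ (e * (a * x + b * y) + (b * x + c * y)) *
      (4 * (e * (a * x + b * y) + (b * x + c * y)) ^ 2 - 3 *
      (a * e ^ 2 + 2 * b * e + c) * (x * (a * x + b * y) + y * (b * x + c * y))) ≠ 0 := by
  set α := x * (a * x + b * y) + y * (b * x + c * y) with hαd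
  by_contra! hcon
  have e0 := hcon 0 (by norm_num)
  have e1 := hcon 1 (by norm_num)
  have e2 := hcon (-1) (by norm_num)
  have e3 := hcon 2 (by norm_num)
  push_cast at e0 e1 e2 e3
  set U := a * x + b * y with hU
  set V := b * x + c * y with hV
  have hQ : a * x ^ 2 + 2 * b * x * y + c * y ^ 2 = α := by rw [hαd, hU, hV]; ring
  have : 2 * 3 * α ^ 3 = 0 := by
    have hF : (x * U + y * V) * (4 * (x * U + y * V) ^ 2 -
        3 * (a * x ^ 2 + 2 * b * x * y + c * y ^ 2) * α) = α ^ 3 := by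
      rw [hQ, ← hαd]; ring
    rw [← hF]
    linear_combination 3 * (x ^ 2 - y ^ 2) * (x - 2 * y) * e0 - 3 * x * (x + y) * (x - 2 * y) * e1 -
      x * (x - y) * (x - 2 * y) * e2 + x * (x ^ 2 - y ^ 2) * e3
  exact (mul_ne_zero (mul_ne_zero h2 h3) (pow_ne_zero 3 hα)) this

theorem exists_direction₂ (hα : x * (a * x + b * y) + y * (b * x + c * y) ≠ 0) :
    ∃ e : ℤ, |e| ≤ 2 ∧ 8 * (e * (a * x + b * y) + (b * x + c * y)) ^ 4 -
      8 * (e * (a * x + b * y) + (b * x + c * y)) ^ 2 * (a * e ^ 2 + 2 * b * e + c) *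
        (x * (a * x + b * y) + y * (b * x + c * y)) +
      (a * e ^ 2 + 2 * b * e + c) ^ 2 * (x * (a * x + b * y) + y * (b * x + c * y)) ^ 2 ≠ 0 := by
  set α := x * (a * x + b * y) + y * (b * x + c * y) with hαd
  by_contra! hcon
  have e0 := hcon 0 (by norm_num)
  have e1 := hcon 1 (by norm_num)
  have e2 := hcon (-1) (by norm_num)
  have e3 := hcon 2 (by norm_num)
  have e4 := hcon (-2) (by norm_num)
  push_cast at e0 e1 e2 e3 e4
  set U := a * x + b * y with hU
  set V := b * x + c * y with hV
  have hQ : a * x ^ 2 + 2 * b * x * y + c * y ^ 2 = α := by rw [hαd, hU, hV]; ring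
  have : 2 ^ 3 * 3 * α ^ 4 = 0 := by
    have hF : 8 * (x * U + y * V) ^ 4 - 8 * (x * U + y * V) ^ 2 *
        (a * x ^ 2 + 2 * b * x * y + c * y ^ 2) * α +
        (a * x ^ 2 + 2 * b * x * y + c * y ^ 2) ^ 2 * α ^ 2 = α ^ 4 := by
      rw [hQ, ← hαd]; ring
    rw [← hF]
    linear_combination 6 * (x ^ 2 - y ^ 2) * (x ^ 2 - 4 * y ^ 2) * e0 -
      4 * x * (x + y) * (x ^ 2 - 4 * y ^ 2) * e1 - 4 * x * (x - y) * (x ^ 2 - 4 * y ^ 2) * e2 +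
      x * (x ^ 2 - y ^ 2) * (x + 2 * y) * e3 + x * (x ^ 2 - y ^ 2) * (x - 2 * y) * e4
  exact (mul_ne_zero (mul_ne_zero (pow_ne_zero 3 h2) h3) (pow_ne_zero 4 hα)) this

end Direction

end BoxSum

/-! ### Primitive characters near 1 -/

namespace BoxSum
open Finset

variable {p n : ℕ} [hp : Fact p.Prime]

/-- A character trivial on 1 + p^(n-1) ℤ factors through modulus p^(n-1), contradicting primitivity.
-/
theorem exists_ne_one_of_isPrimitive {χ : DirichletCharacter ℂ (p ^ n)} (hχ : χ.IsPrimitive)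
    (hn : n ≠ 0) : ∃ x : ℤ, χ (1 + (p : ZMod (p ^ n)) ^ (n - 1) * x) ≠ 1 := by
  by_contra! hcon
  have : NeZero (p ^ n) := ⟨pow_ne_zero _ hp.out.ne_zero⟩
  have hd : p ^ (n - 1) ∣ p ^ n := pow_dvd_pow p (Nat.sub_le n 1)
  have hf : χ.FactorsThrough (p ^ (n - 1)) := by
    rw [DirichletCharacter.factorsThrough_iff_ker_unitsMap hd]
    intro u hu
    rw [MonoidHom.mem_ker] at hu ⊢
    have h1 : ((u : ZMod (p ^ n)).val : ZMod (p ^ (n - 1))) = ((1 : ℤ) : ZMod (p ^ (n - 1))) := by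
      have := congrArg Units.val hu
      rw [ZMod.unitsMap_val] at this
      rw [ZMod.natCast_val, this]; simp
    rw [← Int.cast_natCast, eq_comm, ZMod.intCast_eq_intCast_iff_dvd_sub] at h1
    obtain ⟨x, hx⟩ := h1
    have h2 : (u : ZMod (p ^ n)) = 1 + (p : ZMod (p ^ n)) ^ (n - 1) * x := by
      have h3 : (((u : ZMod (p ^ n)).val : ℤ) : ZMod (p ^ n)) =
          ((1 + (p ^ (n - 1) : ℕ) * x : ℤ) : ZMod (p ^ n)) := by
        rw [← hx]; congr 1; ring
      rw [Int.cast_natCast, ZMod.natCast_zmod_val] at h3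
      rw [h3]; push_cast; ring
    ext
    rw [MulChar.coe_toUnitHom, h2, hcon x]; rfl
  have hle : χ.conductor ≤ p ^ (n - 1) := Nat.sInf_le hf
  rw [hχ] at hle
  exact absurd hle (not_le.2 (Nat.pow_lt_pow_right hp.out.one_lt (by omega)))

/-- A primitive character is a nondegenerate additive character on `1 + p ^ m ℤ` if `n ≤ 2 m`. -/
theorem exists_additive_parameter {χ : DirichletCharacter ℂ (p ^ n)} (hχ : χ.IsPrimitive)
    {m : ℕ} (hm : m ≤ n) (h2 : n ≤ 2 * m) :
    ∃ a : ℤ, ¬ (p : ℤ) ∣ a ∧ ∀ x : ℤ, χ (1 + (p : ZMod (p ^ n)) ^ m * x) =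
      ZMod.stdAddChar (N := p ^ (n - m)) ((a * x : ℤ) : ZMod (p ^ (n - m))) := by
  have hpn : (p : ZMod (p ^ n)) ^ n = 0 := by rw [← Nat.cast_pow, ZMod.natCast_self]
  have hlarge : ∀ k, n ≤ k → (p : ZMod (p ^ n)) ^ k = 0 := fun k hk => pow_eq_zero_of_le hk hpn
  rcases hm.eq_or_lt with rfl | hlt
  -- For m = n both sides are identically 1, so any a prime to p will do.
  · refine ⟨1, fun h => hp.out.one_lt.ne' ?_, fun x => ?_⟩
    · exact Nat.dvd_one.1 (by exact_mod_cast h)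
    · have : Subsingleton (ZMod (p ^ (m - m))) := by
        rw [Nat.sub_self, pow_zero]; infer_instance
      rw [hpn, zero_mul, add_zero, map_one, Subsingleton.elim ((1 * x : ℤ) : ZMod (p ^ (m - m))) 0,
        AddChar.map_zero_eq_one]
  set D := p ^ (n - m) with hD
  have : NeZero D := ⟨pow_ne_zero _ hp.out.ne_zero⟩
  have hDm : (p : ZMod (p ^ n)) ^ m * (D : ZMod (p ^ n)) = 0 := by
    rw [hD, Nat.cast_pow, ← pow_add, Nat.add_sub_cancel' hm, hpn]
  set ζ := χ (1 + (p : ZMod (p ^ n)) ^ m) with hζ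
  have hpow : ∀ k : ℕ, χ (1 + (p : ZMod (p ^ n)) ^ m * k) = ζ ^ k := by
    intro k
    induction k with
    | zero => simp
    | succ k ih =>
      rw [pow_succ, ← ih, hζ, ← map_mul]
      congr 1
      push_cast
      have := hlarge (2 * m) h2
      rw [two_mul, pow_add] at this
      linear_combination -(k : ZMod (p ^ n)) * this
  have hζD : ζ ^ D = 1 := by rw [← hpow, hDm, add_zero, map_one]
  obtain ⟨a, -, ha⟩ := (Complex.isPrimitiveRoot_exp D (NeZero.ne D)).eq_pow_of_pow_eq_one hζD
  have ha' : ζ = ZMod.stdAddChar (N := D) ((a : ℤ) : ZMod D) := by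
    rw [ZMod.stdAddChar_coe, ← ha, ← Complex.exp_nat_mul]
    congr 1
    push_cast; ring
  have hall : ∀ x : ℤ, χ (1 + (p : ZMod (p ^ n)) ^ m * x) =
      ZMod.stdAddChar (N := D) (((a : ℤ) * x : ℤ) : ZMod D) := by
    intro x
    obtain ⟨k, hk⟩ : ∃ k : ℕ, (k : ℤ) = x % D :=
      ⟨(x % D).toNat, Int.toNat_of_nonneg (Int.emod_nonneg _ (by exact_mod_cast NeZero.ne D))⟩
    have hx : x = k + D * (x / D) := by rw [hk, Int.emod_add_mul_ediv]
    have e1 : (1 + (p : ZMod (p ^ n)) ^ m * x) = 1 + (p : ZMod (p ^ n)) ^ m * k := by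
      conv_lhs => rw [hx]
      push_cast
      linear_combination ((x / D : ℤ) : ZMod (p ^ n)) * hDm
    have e2 : (((a : ℤ) * x : ℤ) : ZMod D) = k • ((a : ℤ) : ZMod D) := by
      conv_lhs => rw [hx]
      push_cast
      rw [ZMod.natCast_self, nsmul_eq_mul]; ring
    rw [e1, hpow, ha', e2, AddChar.map_nsmul_eq_pow]
  refine ⟨a, fun hdvd => ?_, hall⟩
  obtain ⟨x, hx⟩ := exists_ne_one_of_isPrimitive hχ (by omega : n ≠ 0)
  apply hx
  -- If p divided a, the additive character would be trivial on multiples of p^(n-1-m), and χ on 1 +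
  -- p^(n-1) ℤ.
  have h3 := hall ((p : ℤ) ^ (n - 1 - m) * x)
  have e : (p : ZMod (p ^ n)) ^ m * (((p : ℤ) ^ (n - 1 - m) * x : ℤ) : ZMod (p ^ n)) =
      (p : ZMod (p ^ n)) ^ (n - 1) * x := by
    push_cast
    rw [← mul_assoc, ← pow_add]; congr 2; omega
  rw [e] at h3
  rw [h3]
  have h4 : (((a : ℤ) * ((p : ℤ) ^ (n - 1 - m) * x) : ℤ) : ZMod D) = 0 := by
    rw [ZMod.intCast_zmod_eq_zero_iff_dvd, hD]
    obtain ⟨c, hc⟩ := hdvd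
    refine ⟨c * x, ?_⟩
    rw [hc]
    push_cast
    rw [show n - m = (n - 1 - m) + 1 by omega, pow_succ]; ring
  rw [h4, AddChar.map_zero_eq_one]

end BoxSum

/-! ### p-adic stationary phase -/

namespace BoxSum
open Finset Polynomial

theorem tsum_int_eq_sum_fin {f : ℤ → ℂ} (hf : Summable f) (N : ℕ) [NeZero N] :
    ∑' s, f s = ∑ r : Fin N, ∑' z : ℤ, f (z * N + (r : ℕ)) := by
  have e : ∀ x : ℤ × Fin N, f ((Int.divModEquiv N).symm x) = f (x.1 * N + (x.2 : ℕ)) := fun x => by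
    rw [Int.divModEquiv_symm_apply]
  have h1 : Summable fun x : ℤ × Fin N => f (x.1 * N + (x.2 : ℕ)) := by
    have := ((Int.divModEquiv N).symm.summable_iff (f := f)).2 hf
    simpa only [Function.comp_def, e] using this
  rw [← (Int.divModEquiv N).symm.tsum_eq f]
  simp_rw [e]
  rw [h1.tsum_prod]
  simp_rw [tsum_fintype]
  exact Summable.tsum_finsetSum fun r _ =>
    h1.comp_injective (i := fun z : ℤ => (z, r)) fun _ _ h => (Prod.ext_iff.1 h).1

/-- The labels i r < N separate the indices with equal j r, so each value of j occurs at most N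
times. -/
theorem sum_le_mul_sum_of_injective {ι κ : Type*} [Fintype ι] [Fintype κ] [DecidableEq κ] {b : κ → ℝ}
    (hb : ∀ j, 0 ≤ b j) (N : ℕ) (j : ι → κ) (i : ι → ℕ) (hi : ∀ r, i r < N)
    (hinj : ∀ r r', j r = j r' → i r = i r' → r = r') : ∑ r, b (j r) ≤ N * ∑ k, b k := by
  have h1 : ∑ r, b (j r) = ∑ x ∈ univ.image (fun r => (j r, i r)), b x.1 := by
    rw [sum_image]
    intro r _ r' _ h
    exact hinj r r' (Prod.ext_iff.1 h).1 (Prod.ext_iff.1 h).2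
  rw [h1]
  calc _ ≤ ∑ x ∈ (univ : Finset κ) ×ˢ range N, b x.1 := by
        refine sum_le_sum_of_subset_of_nonneg ?_ fun x _ _ => hb _
        intro x hx
        obtain ⟨r, _, rfl⟩ := mem_image.1 hx
        exact mem_product.2 ⟨mem_univ _, mem_range.2 (hi r)⟩
    _ = N * ∑ k, b k := by
        rw [sum_product]; simp [mul_sum]

variable {p n : ℕ} [hp : Fact p.Prime]

/-- Frequencies of distinct residues repeat only if the residues are close `p`-adically. -/
theorem dvd_sub_of_frequency_eq {G : (ZMod (p ^ n))[X]} (hn : n ≠ 0) (hG : IsUnit (G.coeff 1))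
    {π' : ZMod (p ^ n)} (hπ : IsUnit π') {k : ℕ} (hk : k ≤ n) {a : ℤ} (ha : ¬ (p : ℤ) ∣ a)
    {r r' y y' : ℤ} (hy : (y : ZMod (p ^ n)) = π' * G.eval ((p : ZMod (p ^ n)) * r))
    (hy' : (y' : ZMod (p ^ n)) = π' * G.eval ((p : ZMod (p ^ n)) * r'))
    (h : ((a * y : ℤ) : ZMod (p ^ k)) = ((a * y' : ℤ) : ZMod (p ^ k))) :
    ((p ^ (k - 1) : ℕ) : ℤ) ∣ r - r' := by
  have hpp : Prime (p : ℤ) := Nat.prime_iff_prime_int.1 hp.out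
  rw [eq_comm, ZMod.intCast_eq_intCast_iff_dvd_sub, ← mul_sub] at h
  push_cast at h
  have hcop : IsCoprime ((p : ℤ) ^ k) a := (hpp.coprime_iff_not_dvd.2 ha).pow_left
  obtain ⟨c, hc⟩ := hcop.dvd_of_dvd_mul_left h
  obtain ⟨u, hu, hGu⟩ := exists_isUnit_eval_sub hn hG (x := (p : ZMod (p ^ n)) * r)
    (y := (p : ZMod (p ^ n)) * r') (dvd_mul_right _ _) (dvd_mul_right _ _)
  obtain ⟨v, hv⟩ := (hu.mul hπ).exists_right_inv
  -- G(pr) - G(pr') is a unit times p(r - r'). The explicit p is the reason the conclusion has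
  -- exponent k - 1.
  have h1 : (p : ZMod (p ^ n)) * ((r - r' : ℤ) : ZMod (p ^ n)) = (p : ZMod (p ^ n)) ^ k * (c * v) := by
    have h2 := congrArg (Int.cast : ℤ → ZMod (p ^ n)) hc
    push_cast at h2 ⊢
    rw [hy, hy'] at h2
    linear_combination v * h2 - v * π' * hGu - (p : ZMod (p ^ n)) * (r - r') * hv
  obtain ⟨w, hw⟩ := ZMod.intCast_surjective ((c : ZMod (p ^ n)) * v)
  have h3 : ((p : ℤ) ^ k) ∣ p * (r - r') := by
    have h4 : ((p ^ k * w : ℤ) : ZMod (p ^ n)) = ((p * (r - r') : ℤ) : ZMod (p ^ n)) := by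
      push_cast at h1 ⊢
      rw [h1, hw]
    rw [ZMod.intCast_eq_intCast_iff_dvd_sub] at h4
    have h5 : ((p : ℤ) ^ k) ∣ p * (r - r') - p ^ k * w :=
      (pow_dvd_pow (p : ℤ) hk).trans (by exact_mod_cast h4)
    exact (dvd_sub_left (dvd_mul_right _ _)).1 h5
  push_cast
  rcases Nat.eq_zero_or_pos k with rfl | hk0
  · simp
  · obtain ⟨l, rfl⟩ : ∃ l, k = l + 1 := ⟨k - 1, by omega⟩
    rw [pow_succ, mul_comm] at h3
    simpa using Int.dvd_of_mul_dvd_mul_left (by exact_mod_cast hp.out.ne_zero) h3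

/-- A smooth weighted sum of `χ (ψ (p s))`. -/
noncomputable def phaseSum (χ : DirichletCharacter ℂ (p ^ n)) (ψ : ZMod (p ^ n) → ZMod (p ^ n))
    (W : ℤ → ℝ) : ℂ :=
  ∑' s : ℤ, (W s : ℂ) * χ (ψ ((p : ZMod (p ^ n)) * (s : ZMod (p ^ n))))

theorem SuppIn.ofReal_mul {W : ℤ → ℝ} {A X : ℝ} (h : SuppIn W A X) (f : ℤ → ℂ) :
    SuppIn (fun s => (W s : ℂ) * f s) A X :=
  fun t ht => h t (Complex.ofReal_ne_zero.1 (left_ne_zero_of_mul ht))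

theorem phaseSum_trivial (χ : DirichletCharacter ℂ (p ^ n)) (ψ : ZMod (p ^ n) → ZMod (p ^ n))
    {W : ℤ → ℝ} {A X C : ℝ} (hX : 1 ≤ X) (hs : SuppIn W A X) (hW : ∀ t, |W t| ≤ C) :
    ‖phaseSum χ ψ W‖ ≤ 2 * C * X := by
  have hC : 0 ≤ C := (abs_nonneg _).trans (hW 0)
  refine ((hs.ofReal_mul _).norm_tsum_le (by linarith) (B := C) fun s => ?_).trans (by nlinarith)
  rw [norm_mul, Complex.norm_real, Real.norm_eq_abs]
  exact (mul_le_of_le_one_right (abs_nonneg _) (χ.norm_le_one _)).trans (hW s)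

/-- `p`-adic stationary phase in the nondegenerate case. -/
theorem norm_phaseSum_le {χ : DirichletCharacter ℂ (p ^ n)} (hχ : χ.IsPrimitive)
    {ψ : ZMod (p ^ n) → ZMod (p ^ n)} {m : ℕ} {π' : ZMod (p ^ n)} {G : (ZMod (p ^ n))[X]}
    (hπ : IsUnit π') (hψ : LogDer ψ ((p : ZMod (p ^ n)) ^ m * π') G) (hG : IsUnit (G.coeff 1))
    {W : ℤ → ℝ} {A X C : ℝ} (hX : 1 ≤ X) (hs : SuppIn W A X) (hW : IsSmooth X C W) :
    ‖phaseSum χ ψ W‖ ≤ 16 * C * p ^ 3 *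
      (X * √((p : ℝ) ^ m / p ^ n) + √((p : ℝ) ^ n / p ^ m)) := by
  have hC : 0 ≤ C := (abs_nonneg _).trans (hW.bound 0)
  have hp1 : (1 : ℝ) ≤ p := by exact_mod_cast hp.out.one_lt.le
  have hp0 : (0 : ℝ) < p := by linarith
  have hp3 : (1 : ℝ) ≤ (p : ℝ) ^ 3 := one_le_pow₀ hp1
  have hX0 : 0 < X := by linarith
  have htriv := phaseSum_trivial χ ψ hX hs hW.bound
  rcases le_or_gt n m with hmn | hmn
  · refine htriv.trans ?_
    have h1 : 1 ≤ √((p : ℝ) ^ m / p ^ n) := by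
      rw [Real.one_le_sqrt, one_le_div (by positivity)]
      exact pow_le_pow_right₀ hp1 hmn
    calc 2 * C * X ≤ 16 * C * p ^ 3 * (X * 1 + 0) := by
          have : C * X * 1 ≤ C * X * p ^ 3 := by gcongr
          nlinarith [mul_nonneg hC hX0.le]
      _ ≤ _ := by gcongr; positivity
  have hn : n ≠ 0 := by omega
  -- The variable is split as s = z p^κ + r. The balance of κ and κ' kills the quadratic term in z
  -- and leaves an additive character modulo p^κ'.
  obtain ⟨κ, κ', hκ1, hκ2, hκ3⟩ : ∃ κ κ' : ℕ, m + κ + κ' + 1 = n ∧ κ' ≤ κ ∧ κ ≤ κ' + 1 :=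
    ⟨(n - m) / 2, (n - m - 1) / 2, by omega, by omega, by omega⟩
  have hD1 : (p : ℝ) ^ κ' ≤ √((p : ℝ) ^ n / p ^ m) := by
    apply Real.le_sqrt_of_sq_le
    rw [le_div_iff₀ (by positivity), ← pow_mul, ← pow_add]
    exact pow_le_pow_right₀ hp1 (by omega)
  have hD2 : 1 / (p : ℝ) ^ (κ + 1) ≤ √((p : ℝ) ^ m / p ^ n) := by
    apply Real.le_sqrt_of_sq_le
    rw [div_pow, one_pow, div_le_div_iff₀ (by positivity) (by positivity), one_mul, ← pow_mul,
      ← pow_add]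
    exact pow_le_pow_right₀ hp1 (by omega)
  have hD3 : (p : ℝ) ^ κ ≤ p * p ^ κ' := by
    rw [← pow_succ']; exact pow_le_pow_right₀ hp1 hκ3
  -- Shorter sums are covered by the trivial bound, as p^κ ≤ p √(p^n/p^m).
  rcases lt_or_ge X ((p : ℝ) ^ κ) with hXκ | hXκ
  · refine htriv.trans ?_
    calc 2 * C * X ≤ 2 * C * (p * p ^ κ') := by gcongr; linarith
      _ ≤ 2 * C * (p ^ 3 * √((p : ℝ) ^ n / p ^ m)) := by
        gcongr
        exact le_self_pow₀ hp1 (by norm_num)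
      _ ≤ 16 * C * (p ^ 3 * √((p : ℝ) ^ n / p ^ m)) := by gcongr; norm_num
      _ = 16 * C * p ^ 3 * (0 + √((p : ℝ) ^ n / p ^ m)) := by ring
      _ ≤ _ := by gcongr; positivity
  set μ := m + κ + 1 with hμ
  obtain ⟨a, ha, hadd⟩ := exists_additive_parameter hχ (m := μ) (by omega) (by omega)
  have hnμ : n - μ = κ' := by omega
  rw [hnμ] at hadd
  set D := p ^ κ' with hD
  have : NeZero D := ⟨pow_ne_zero _ hp.out.ne_zero⟩
  have : NeZero (p ^ κ) := ⟨pow_ne_zero _ hp.out.ne_zero⟩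
  choose y hy using fun r : ℤ => ZMod.intCast_surjective
    (π' * G.eval ((p : ZMod (p ^ n)) * (r : ZMod (p ^ n))))
  set Z := X / (p : ℝ) ^ κ with hZ
  have hZ1 : 1 ≤ Z := (one_le_div (by positivity)).2 hXκ
  set b : ZMod D → ℝ := fun j =>
    8 * C * D ^ 2 / Z * (1 / (|(j.valMinAbs : ℝ)| + D / Z) ^ 2) with hb
  have hinner : ∀ r : ℤ, ‖∑' z : ℤ, (W (z * (p ^ κ : ℕ) + r) : ℂ) *
      χ (ψ ((p : ZMod (p ^ n)) * ((z * (p ^ κ : ℕ) + r : ℤ) : ZMod (p ^ n))))‖ ≤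
      b ((a * y r : ℤ) : ZMod D) := by
    intro r
    set j : ZMod D := ((a * y r : ℤ) : ZMod D) with hj
    have hval : ∀ z : ℤ, χ (ψ ((p : ZMod (p ^ n)) * ((z * (p ^ κ : ℕ) + r : ℤ) : ZMod (p ^ n)))) =
        χ (ψ ((p : ZMod (p ^ n)) * r)) * ZMod.stdAddChar (j * (z : ZMod D)) := by
      intro z
      obtain ⟨H, hH⟩ := hψ.expand ((p : ZMod (p ^ n)) * ((p : ZMod (p ^ n)) ^ κ * z))
        (dvd_mul_right _ _)
      have h1 := hH ((p : ZMod (p ^ n)) * r) (dvd_mul_right _ _)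
      have e1 : (p : ZMod (p ^ n)) * ((z * (p ^ κ : ℕ) + r : ℤ) : ZMod (p ^ n)) =
          (p : ZMod (p ^ n)) * r + p * (p ^ κ * z) := by push_cast; ring
      have hz : (p : ZMod (p ^ n)) ^ (m + 2 * κ + 2) = 0 := by
        refine pow_eq_zero_of_le (by omega : n ≤ m + 2 * κ + 2) ?_
        rw [← Nat.cast_pow, ZMod.natCast_self]
      have e2 : (1 : ZMod (p ^ n)) + p ^ m * π' * (p * (p ^ κ * z)) *
          (G.eval ((p : ZMod (p ^ n)) * r) + p * (p ^ κ * z) * H.eval ((p : ZMod (p ^ n)) * r)) =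
          1 + p ^ μ * ((y r * z : ℤ) : ZMod (p ^ n)) := by
        push_cast
        rw [hy r, hμ]
        linear_combination π' * z ^ 2 * H.eval ((p : ZMod (p ^ n)) * r) * hz
      rw [e1, h1, e2, map_mul, hadd, hj]
      congr 2
      push_cast; ring
    have h2 := norm_linear_sum_le (ω := fun z : ℤ => W (z * (p ^ κ : ℕ) + r))
      (A := (A - r) / (p : ℝ) ^ κ) (C := C) hZ1 ?_ (fun z => hW.bound _) ?_ j
    · simp_rw [hval]
      have e3 : ∀ z : ℤ, (W (z * (p ^ κ : ℕ) + r) : ℂ) *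
          (χ (ψ ((p : ZMod (p ^ n)) * r)) * ZMod.stdAddChar (j * (z : ZMod D))) =
          χ (ψ ((p : ZMod (p ^ n)) * r)) * ((W (z * (p ^ κ : ℕ) + r) : ℂ) *
            ZMod.stdAddChar (j * (z : ZMod D))) := fun z => by ring
      simp_rw [e3]
      rw [tsum_mul_left, norm_mul]
      exact (mul_le_of_le_one_left (norm_nonneg _) (χ.norm_le_one _)).trans h2
    · intro z hz
      obtain ⟨h3, h4⟩ := hs _ hz
      push_cast at h3 h4
      have hpk : (0 : ℝ) < (p : ℝ) ^ κ := by positivity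
      rw [hZ, ← add_div, div_le_iff₀ hpk, le_div_iff₀ hpk]
      constructor <;> linarith
    · intro z
      have h3 := hW.diff₂ (z * (p ^ κ : ℕ) + r) (p ^ κ : ℕ)
      rw [show (z + 1) * ((p ^ κ : ℕ) : ℤ) + r = z * (p ^ κ : ℕ) + r + (p ^ κ : ℕ) by ring,
        show (z - 1) * ((p ^ κ : ℕ) : ℤ) + r = z * (p ^ κ : ℕ) + r - (p ^ κ : ℕ) by ring]
      refine h3.trans (le_of_eq ?_)
      rw [hZ]
      push_cast
      field_simp
  have hsplit : phaseSum χ ψ W = ∑ r : Fin (p ^ κ), ∑' z : ℤ,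
      (W (z * (p ^ κ : ℕ) + ((r : ℕ) : ℤ)) : ℂ) *
      χ (ψ ((p : ZMod (p ^ n)) * ((z * (p ^ κ : ℕ) + ((r : ℕ) : ℤ) : ℤ) : ZMod (p ^ n)))) :=
    tsum_int_eq_sum_fin (hs.ofReal_mul _).summable (p ^ κ)
  have hb0 : ∀ j, 0 ≤ b j := fun j => by
    have : 0 ≤ Z := by linarith
    simp only [hb]; positivity
  -- Equal frequencies force r ≡ r' modulo p^(κ'-1). With r < p^κ and κ ≤ κ' + 1, the quotient by
  -- p^(κ'-1) takes at most p² values and determines r.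
  have hfib := sum_le_mul_sum_of_injective hb0 (p ^ 2)
    (fun r : Fin (p ^ κ) => ((a * y ((r : ℕ) : ℤ) : ℤ) : ZMod D))
    (fun r => (r : ℕ) / p ^ (κ' - 1)) ?_ ?_
  · rw [hsplit]
    have h5 : (D : ℝ) = (p : ℝ) ^ κ' := by rw [hD]; push_cast; rfl
    calc _ ≤ ∑ r : Fin (p ^ κ), b ((a * y ((r : ℕ) : ℤ) : ℤ) : ZMod D) :=
          (norm_sum_le _ _).trans (sum_le_sum fun r _ => hinner _)
      _ ≤ ((p ^ 2 : ℕ) : ℝ) * (8 * C * (Z + 2 * D)) :=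
          hfib.trans (mul_le_mul_of_nonneg_left (sum_linear_bound_le hZ1 hC) (by positivity))
      _ ≤ (p : ℝ) ^ 2 * (8 * C * (X * (p * √((p : ℝ) ^ m / p ^ n)) +
            2 * √((p : ℝ) ^ n / p ^ m))) := by
          rw [h5]
          push_cast
          gcongr
          rw [hZ, div_eq_mul_one_div]
          gcongr
          calc 1 / (p : ℝ) ^ κ = p * (1 / (p : ℝ) ^ (κ + 1)) := by
                rw [pow_succ]; field_simp
            _ ≤ _ := by gcongr
      _ ≤ (p : ℝ) ^ 2 * (8 * C * (2 * X * (p * √((p : ℝ) ^ m / p ^ n)) +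
            2 * (p * √((p : ℝ) ^ n / p ^ m)))) := by
          gcongr
          · linarith
          · exact le_mul_of_one_le_left (Real.sqrt_nonneg _) hp1
      _ = _ := by ring
  · intro r
    have h1 : (r : ℕ) < p ^ κ := r.2
    rw [Nat.div_lt_iff_lt_mul (pow_pos hp.out.pos _), ← pow_add]
    exact h1.trans_le (Nat.pow_le_pow_right hp.out.pos (by omega))
  · intro r r' h1 h2
    have h3 := dvd_sub_of_frequency_eq hn hG hπ (k := κ') (by omega) ha (hy _) (hy _) h1
    have h4 : (r' : ℕ) ≡ r [MOD p ^ (κ' - 1)] := by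
      rw [Nat.modEq_iff_dvd]; exact h3
    apply Fin.ext
    rw [← Nat.div_add_mod (r : ℕ) (p ^ (κ' - 1)), ← Nat.div_add_mod (r' : ℕ) (p ^ (κ' - 1))]
    rw [h2, h4]

end BoxSum

/-! ### Weyl steps for phase sums -/

namespace BoxSum
open Finset Polynomial

variable {p n : ℕ} [hp : Fact p.Prime]

/-- The values of ψ are units, so complex conjugation of χ(ψ) amounts to inverting ψ. -/
theorem corr_phase {χ : DirichletCharacter ℂ (p ^ n)} {ψ : ZMod (p ^ n) → ZMod (p ^ n)}
    (hψ : ∀ x, (p : ZMod (p ^ n)) ∣ x → IsUnit (ψ x)) (W : ℤ → ℝ) (d : ℤ) :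
    corr (fun s : ℤ => (W s : ℂ) * χ (ψ ((p : ZMod (p ^ n)) * (s : ZMod (p ^ n))))) d =
      phaseSum χ (mulDiff ψ (p * d)) (fun s => W (s + d) * W s) := by
  refine tsum_congr fun s => ?_
  have hu := hψ ((p : ZMod (p ^ n)) * (s : ZMod (p ^ n))) (dvd_mul_right _ _)
  have h1 : (starRingEnd ℂ) (χ (ψ ((p : ZMod (p ^ n)) * (s : ZMod (p ^ n))))) =
      χ (ψ ((p : ZMod (p ^ n)) * (s : ZMod (p ^ n))))⁻¹ := by
    have h2 : χ (ψ ((p : ZMod (p ^ n)) * (s : ZMod (p ^ n)))) *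
        χ (ψ ((p : ZMod (p ^ n)) * (s : ZMod (p ^ n))))⁻¹ = 1 := by
      rw [← map_mul, ZMod.mul_inv_of_unit _ hu, map_one]
    have h3 : ‖χ (ψ ((p : ZMod (p ^ n)) * (s : ZMod (p ^ n))))‖ = 1 := by
      obtain ⟨u, hu⟩ := hu
      rw [← hu]; exact χ.unit_norm_eq_one u
    rw [← Complex.inv_eq_conj h3]
    exact inv_eq_of_mul_eq_one_right h2
  beta_reduce
  rw [map_mul, Complex.conj_ofReal, h1, mulDiff, map_mul]
  have e : (p : ZMod (p ^ n)) * ((s + d : ℤ) : ZMod (p ^ n)) = p * s + p * d := by push_cast; ring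
  rw [e]
  push_cast
  ring

theorem sqrt_mul_pow_div_le (x y : ℕ) (v : ℕ) :
    √((p : ℝ) ^ (x + 1 + v) / p ^ y) ≤ p * √((p : ℝ) ^ x / p ^ y) * √((p : ℝ) ^ v) := by
  have hp1 : (1 : ℝ) ≤ p := by exact_mod_cast hp.out.one_lt.le
  rw [show (p : ℝ) ^ (x + 1 + v) / p ^ y = p * ((p : ℝ) ^ x / p ^ y) * p ^ v by
    rw [pow_add, pow_succ]; ring, Real.sqrt_mul (by positivity), Real.sqrt_mul (by positivity)]
  gcongr
  rw [Real.sqrt_le_left (by linarith)]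
  exact le_self_pow₀ hp1 (by norm_num)

theorem sqrt_div_pow_le (x y : ℕ) (v : ℕ) :
    √((p : ℝ) ^ y / p ^ (x + 1 + v)) ≤ √((p : ℝ) ^ y / p ^ x) := by
  have hp1 : (1 : ℝ) ≤ p := by exact_mod_cast hp.out.one_lt.le
  have hp0 : (0 : ℝ) < p := by linarith
  gcongr
  omega

/-- The shift `P d` of the weighted phase is again a phase sum. -/
theorem exists_logDer_shift {ψ : ZMod (p ^ n) → ZMod (p ^ n)} {m : ℕ} {π' : ZMod (p ^ n)}
    {G : (ZMod (p ^ n))[X]} (hπ : IsUnit π')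
    (hψ : LogDer ψ ((p : ZMod (p ^ n)) ^ m * π') G) (k : ℕ) {d : ℕ} (hd : 0 < d) :
    ∃ π'' : ZMod (p ^ n), IsUnit π'' ∧ ∃ K : (ZMod (p ^ n))[X],
      LogDer (mulDiff ψ (p * (((p ^ k : ℕ) * d : ℤ) : ZMod (p ^ n))))
        ((p : ZMod (p ^ n)) ^ (m + k + 1 + padicValNat p d) * π'') (derivative G + C (p : ZMod (p ^ n)) * K) := by
  obtain ⟨d', hd'⟩ := pow_padicValNat_dvd (p := p) (n := d)
  set v := padicValNat p d with hv
  have hcop : ¬ p ∣ d' := by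
    rintro ⟨c, rfl⟩
    apply pow_succ_padicValNat_not_dvd (p := p) hd.ne'
    rw [← hv]
    exact ⟨c, by rw [hd', pow_succ]; ring⟩
  have hu : IsUnit ((d' : ℕ) : ZMod (p ^ n)) := by
    rw [ZMod.isUnit_iff_coprime]
    exact ((hp.out.coprime_iff_not_dvd.2 hcop).symm).pow_right n
  obtain ⟨K, hK⟩ := hψ.mulDiff (δ := p * (((p ^ k : ℕ) * d : ℤ) : ZMod (p ^ n))) (dvd_mul_right _ _)
  refine ⟨π' * d', hπ.mul hu, C (((p ^ k : ℕ) * d : ℤ) : ZMod (p ^ n)) * K, ?_⟩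
  have e1 : (p : ZMod (p ^ n)) ^ m * π' * (p * (((p ^ k : ℕ) * d : ℤ) : ZMod (p ^ n))) =
      (p : ZMod (p ^ n)) ^ (m + k + 1 + v) * (π' * d') := by
    rw [hd']
    push_cast
    ring
  rw [e1, C_mul, mul_assoc] at hK
  exact hK

theorem isUnit_natCast_mul_add (hn : n ≠ 0) {a : ℕ} (ha : ¬ p ∣ a) {x : ZMod (p ^ n)} (hx : IsUnit x)
    (y : ZMod (p ^ n)) : IsUnit (x * a + p * y) := by
  rw [isUnit_iff_red_ne_zero hn] at hx ⊢
  rw [map_add, map_mul, map_mul, map_natCast, map_natCast, ZMod.natCast_self, zero_mul, add_zero]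
  exact mul_ne_zero hx (by rwa [Ne, ZMod.natCast_eq_zero_iff])

/-- One Weyl step applied to phase sums, given a bound for the differenced sums. -/
theorem phaseSum_weyl (χ : DirichletCharacter ℂ (p ^ n))
    {ψ : ZMod (p ^ n) → ZMod (p ^ n)} (hψ : ∀ x, (p : ZMod (p ^ n)) ∣ x → IsUnit (ψ x))
    {W : ℤ → ℝ} {A X C : ℝ} (hX : 1 ≤ X) (hs : SuppIn W A X) (hW : IsSmooth X C W) (k : ℕ)
    {e₁ e₂ : ℝ} (he₁ : 0 ≤ e₁) (he₂ : 0 ≤ e₂)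
    (hT : ∀ d : ℕ, 0 < d → ‖phaseSum χ (mulDiff ψ (p * (((p ^ k : ℕ) * d : ℤ) : ZMod (p ^ n))))
      (fun s => W (s + ((p ^ k : ℕ) * d : ℤ)) * W s)‖ ≤ e₂ + e₁ * √((p : ℝ) ^ padicValNat p d)) :
    ‖phaseSum χ ψ W‖ ^ 2 ≤ 3 * X * (16 * C ^ 2 * p ^ k + 2 * e₂ + 8 * e₁) := by
  have hC : 0 ≤ C := (abs_nonneg _).trans (hW.bound 0)
  have hp0 : (0 : ℝ) < p := by exact_mod_cast hp.out.pos
  have hX0 : 0 < X := by linarith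
  have hPk : (0 : ℝ) < (p : ℝ) ^ k := by positivity
  -- If no shift by p^k fits, the diagonal term C² p^k X already dominates the trivial bound.
  rcases lt_or_ge X ((p : ℝ) ^ k) with hlt | hle
  · have h1 := phaseSum_trivial χ ψ hX hs hW.bound
    calc ‖phaseSum χ ψ W‖ ^ 2 ≤ (2 * C * X) ^ 2 := by gcongr
      _ = 4 * X * (C ^ 2 * X) := by ring
      _ ≤ 4 * X * (C ^ 2 * p ^ k) := by gcongr
      _ ≤ 3 * X * (16 * C ^ 2 * p ^ k + 0 + 0) := by
        nlinarith [mul_nonneg hX0.le (mul_nonneg (sq_nonneg C) hPk.le)]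
      _ ≤ _ := by gcongr <;> positivity
  · set H := ⌊X / (p : ℝ) ^ k⌋₊ with hH
    have hH1 : 1 ≤ H := Nat.le_floor (by simpa using (one_le_div hPk).2 hle)
    have hHr : (1 : ℝ) ≤ H := by exact_mod_cast hH1
    have hH2 : ((p ^ k : ℕ) : ℝ) * H ≤ X := by
      have := Nat.floor_le (a := X / (p : ℝ) ^ k) (by positivity)
      rw [le_div_iff₀ hPk] at this
      push_cast
      linarith
    have hH3 : X ≤ 2 * H * (p : ℝ) ^ k := by
      have := Nat.lt_floor_add_one (X / (p : ℝ) ^ k)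
      rw [div_lt_iff₀ hPk] at this
      nlinarith
    have h0 : ‖corr (fun s : ℤ => (W s : ℂ) * χ (ψ ((p : ZMod (p ^ n)) * (s : ZMod (p ^ n))))) 0‖ ≤
        8 * C ^ 2 * X := by
      rw [corr_phase hψ]
      have h1 := (hW.shift 0).mul hX0 hW
      refine (phaseSum_trivial χ _ hX (A := A) ?_ h1.bound).trans (by nlinarith)
      intro t ht
      exact hs t (right_ne_zero_of_mul ht)
    have h1 := weyl_inequality_padic hp.out (hs.ofReal_mul _) hX H (p ^ k) hH1 hH2 he₁ he₂ h0
      (fun d hd => by rw [corr_phase hψ]; exact hT d hd)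
    refine h1.trans ?_
    gcongr
    rw [div_le_iff₀ (by linarith)]
    nlinarith [mul_le_mul_of_nonneg_left hH3 (sq_nonneg C)]

theorem suppIn_shift_mul {W : ℤ → ℝ} {A X : ℝ} (hs : SuppIn W A X) (d : ℤ) :
    SuppIn (fun s => W (s + d) * W s) A X :=
  fun t ht => hs t (right_ne_zero_of_mul ht)

/-- A shift p^k d with v = v_p(d) turns the unit quadratic coefficient into a unit linear one at
level m + k + 1 + v, where stationary phase applies. The loss √(p^v) is bounded on average over d.
-/
theorem norm_phaseSum_sq_le {χ : DirichletCharacter ℂ (p ^ n)} (hχ : χ.IsPrimitive) (hn : n ≠ 0)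
    (hp3 : 3 < p) {ψ : ZMod (p ^ n) → ZMod (p ^ n)} {m : ℕ} {π' : ZMod (p ^ n)}
    {G : (ZMod (p ^ n))[X]}
    (hπ : IsUnit π') (hψ : LogDer ψ ((p : ZMod (p ^ n)) ^ m * π') G) (hG : IsUnit (G.coeff 2))
    {W : ℤ → ℝ} {A X C : ℝ} (hX : 1 ≤ X) (hs : SuppIn W A X) (hW : IsSmooth X C W) (k : ℕ) :
    ‖phaseSum χ ψ W‖ ^ 2 ≤ 1536 * C ^ 2 * p ^ 4 * X *
      (p ^ k + √((p : ℝ) ^ n / p ^ (m + k)) + X * √((p : ℝ) ^ (m + k) / p ^ n)) := by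
  have hC : 0 ≤ C := (abs_nonneg _).trans (hW.bound 0)
  have hp1 : (1 : ℝ) ≤ p := by exact_mod_cast hp.out.one_lt.le
  have hp0 : (0 : ℝ) < p := by linarith
  have hX0 : 0 < X := by linarith
  set E₂ := √((p : ℝ) ^ n / p ^ (m + k))
  set E₁ := √((p : ℝ) ^ (m + k) / p ^ n)
  have hE₁ : 0 ≤ E₁ := Real.sqrt_nonneg _
  have hE₂ : 0 ≤ E₂ := Real.sqrt_nonneg _
  have h := phaseSum_weyl χ hψ.isUnit hX hs hW k (e₁ := 64 * C ^ 2 * p ^ 4 * (X * E₁))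
    (e₂ := 64 * C ^ 2 * p ^ 3 * E₂) (by positivity) (by positivity) ?_
  · refine h.trans ?_
    have h34 : (p : ℝ) ^ 3 ≤ p ^ 4 := pow_le_pow_right₀ hp1 (by norm_num)
    have h14 : (1 : ℝ) ≤ p ^ 4 := one_le_pow₀ hp1
    calc _ ≤ 3 * X * (16 * C ^ 2 * (p ^ 4 * p ^ k) + 2 * (64 * C ^ 2 * p ^ 4 * E₂) +
          8 * (64 * C ^ 2 * p ^ 4 * (X * E₁))) := by
          gcongr
          exact le_mul_of_one_le_left (by positivity) h14
      _ ≤ 3 * X * (512 * C ^ 2 * (p ^ 4 * p ^ k) + 512 * C ^ 2 * p ^ 4 * E₂ +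
          512 * C ^ 2 * p ^ 4 * (X * E₁)) := by
          have a1 : 0 ≤ C ^ 2 * ((p : ℝ) ^ 4 * p ^ k) := by positivity
          have a2 : 0 ≤ C ^ 2 * (p : ℝ) ^ 4 * E₂ := by positivity
          exact mul_le_mul_of_nonneg_left (by linarith) (by positivity)
      _ = _ := by ring
  · intro d hd
    obtain ⟨π'', hπ'', K, hK⟩ := exists_logDer_shift hπ hψ k hd
    have hcoef : IsUnit ((derivative G + Polynomial.C (p : ZMod (p ^ n)) * K).coeff 1) := by
      rw [coeff_add, coeff_derivative, coeff_C_mul]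
      have := isUnit_natCast_mul_add hn (a := 2) (fun h => by
        have := Nat.le_of_dvd (by norm_num) h; omega) hG (K.coeff 1)
      convert this using 3
      norm_num
    refine (norm_phaseSum_le hχ hπ'' hK hcoef hX (suppIn_shift_mul hs _)
      ((hW.shift _).mul hX0 hW)).trans ?_
    have b1 := sqrt_mul_pow_div_le (p := p) (m + k) n (padicValNat p d)
    have b2 := sqrt_div_pow_le (p := p) (m + k) n (padicValNat p d)
    calc _ ≤ 16 * (4 * C * C) * p ^ 3 * (X * (p * E₁ * √((p : ℝ) ^ padicValNat p d)) + E₂) := by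
          gcongr
      _ = _ := by ring

/-- A first step by multiples of p^k₁ lowers the unit cubic coefficient to a quadratic one; the
differenced sums are bounded by the one-step estimate with k₂. -/
theorem norm_phaseSum_sq_le' {χ : DirichletCharacter ℂ (p ^ n)} (hχ : χ.IsPrimitive) (hn : n ≠ 0)
    (hp3 : 3 < p) {ψ : ZMod (p ^ n) → ZMod (p ^ n)} {m : ℕ} {π' : ZMod (p ^ n)}
    {G : (ZMod (p ^ n))[X]}
    (hπ : IsUnit π') (hψ : LogDer ψ ((p : ZMod (p ^ n)) ^ m * π') G) (hG : IsUnit (G.coeff 3))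
    {W : ℤ → ℝ} {A X C : ℝ} (hX : 1 ≤ X) (hs : SuppIn W A X) (hW : IsSmooth X C W) (k₁ k₂ : ℕ) :
    ‖phaseSum χ ψ W‖ ^ 2 ≤ 3768 * C ^ 2 * p ^ 3 * X *
      (p ^ k₁ + √(X * (p ^ k₂ + √((p : ℝ) ^ n / p ^ (m + k₁ + k₂)) +
        X * √((p : ℝ) ^ (m + k₁ + k₂) / p ^ n)))) := by
  have hC : 0 ≤ C := (abs_nonneg _).trans (hW.bound 0)
  have hp1 : (1 : ℝ) ≤ p := by exact_mod_cast hp.out.one_lt.le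
  have hp0 : (0 : ℝ) < p := by linarith
  have hX0 : 0 < X := by linarith
  set E₂ := √((p : ℝ) ^ n / p ^ (m + k₁ + k₂))
  set E₁ := √((p : ℝ) ^ (m + k₁ + k₂) / p ^ n)
  set Y := (p : ℝ) ^ k₂ + E₂ + X * E₁ with hY
  have hE₁ : 0 ≤ E₁ := Real.sqrt_nonneg _
  have hE₂ : 0 ≤ E₂ := Real.sqrt_nonneg _
  have hY0 : 0 ≤ Y := by positivity
  have h := phaseSum_weyl χ hψ.isUnit hX hs hW k₁ (e₁ := 157 * C ^ 2 * p ^ 3 * √(X * Y))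
    (e₂ := 0) (by positivity) le_rfl ?_
  · refine h.trans ?_
    have h13 : (1 : ℝ) ≤ p ^ 3 := one_le_pow₀ hp1
    calc _ ≤ 3 * X * (16 * C ^ 2 * (p ^ 3 * p ^ k₁) + 2 * 0 +
          8 * (157 * C ^ 2 * p ^ 3 * √(X * Y))) := by
          gcongr
          exact le_mul_of_one_le_left (by positivity) h13
      _ ≤ 3 * X * (1256 * C ^ 2 * (p ^ 3 * p ^ k₁) + 2 * 0 +
          8 * (157 * C ^ 2 * p ^ 3 * √(X * Y))) := by
          gcongr
          norm_num
      _ = _ := by ring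
  · intro d hd
    obtain ⟨π'', hπ'', K, hK⟩ := exists_logDer_shift hπ hψ k₁ hd
    have hcoef : IsUnit ((derivative G + Polynomial.C (p : ZMod (p ^ n)) * K).coeff 2) := by
      rw [coeff_add, coeff_derivative, coeff_C_mul]
      have := isUnit_natCast_mul_add hn (a := 3) (fun h => by
        have := Nat.le_of_dvd (by norm_num) h; omega) hG (K.coeff 2)
      convert this using 3
      norm_num
    have h1 := norm_phaseSum_sq_le hχ hn hp3 hπ'' hK hcoef hX (suppIn_shift_mul hs _)
      ((hW.shift ((p ^ k₁ : ℕ) * d : ℤ)).mul hX0 hW) k₂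
    set v := padicValNat p d
    have b1 := sqrt_mul_pow_div_le (p := p) (m + k₁ + k₂) n v
    have b2 := sqrt_div_pow_le (p := p) (m + k₁ + k₂) n v
    rw [show m + k₁ + k₂ + 1 + v = m + k₁ + 1 + v + k₂ by ring] at b1 b2
    have hv : (1 : ℝ) ≤ p ^ v := one_le_pow₀ hp1
    have hv' : 1 ≤ √((p : ℝ) ^ v) := Real.one_le_sqrt.2 hv
    set V := √((p : ℝ) ^ v) with hV
    rw [zero_add]
    refine abs_le_of_sq_le_sq' ?_ (by positivity) |>.2
    refine h1.trans ?_
    have hV2 : V ^ 2 = (p : ℝ) ^ v := Real.sq_sqrt (by positivity)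
    have hsq : √(X * Y) ^ 2 = X * Y := Real.sq_sqrt (by positivity)
    calc _ ≤ 1536 * (4 * C * C) ^ 2 * p ^ 4 * X * (p ^ k₂ + E₂ + X * (p * E₁ * V)) := by gcongr
      _ ≤ 1536 * (4 * C * C) ^ 2 * p ^ 4 * X * (p * V * p ^ k₂ + p * V * E₂ + X * (p * E₁ * V)) := by
          have : 1 ≤ p * V := one_le_mul_of_one_le_of_one_le hp1 hv'
          gcongr
          · exact le_mul_of_one_le_left (by positivity) this
          · exact le_mul_of_one_le_left (by positivity) this
      _ = 24576 * C ^ 4 * p ^ 5 * (X * Y) * V := by rw [hY]; ring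
      -- 157 is the least integer whose square exceeds 24576 = 1536 · 4². Replacing V by V² supplies
      -- the factor √(p^v) after the square root.
      _ ≤ 157 ^ 2 * C ^ 4 * p ^ 6 * (X * Y) * V ^ 2 := by
          gcongr
          · norm_num
          · norm_num
          · exact le_self_pow₀ hv' (by norm_num)
      _ = (157 * C ^ 2 * p ^ 3 * √(X * Y) * V) ^ 2 := by
          rw [mul_pow, mul_pow, hsq]; ring

end BoxSum

/-! ### Optimized bounds along lines -/

namespace BoxSum
open Finset Polynomial

variable {p n : ℕ} [hp : Fact p.Prime]

theorem exists_pow_near_prime (p : ℕ) [hp : Fact p.Prime] {y : ℝ} (hy : 1 ≤ y) :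
    ∃ k : ℕ, (p : ℝ) ^ k ≤ y ∧ y ≤ p ^ k * p := by
  obtain ⟨k, h1, h2⟩ := exists_nat_pow_near hy
    (show (1 : ℝ) < p by exact_mod_cast hp.out.one_lt)
  exact ⟨k, h1, by rw [← pow_succ]; exact h2.le⟩

theorem rpow_one_third_pow {q : ℝ} (hq : 0 ≤ q) : (q ^ ((1 : ℝ) / 3)) ^ 3 = q := by
  rw [← Real.rpow_natCast, ← Real.rpow_mul hq]; norm_num

theorem rpow_one_seventh_pow {q : ℝ} (hq : 0 ≤ q) : (q ^ ((1 : ℝ) / 7)) ^ 7 = q := by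
  rw [← Real.rpow_natCast, ← Real.rpow_mul hq]; norm_num

theorem sqrt_mul_rpow_one_third {q N : ℝ} (hq : 0 ≤ q) (hN : 0 ≤ N) :
    √(N * q ^ ((1 : ℝ) / 3)) = N ^ ((1 : ℝ) / 2) * q ^ ((1 : ℝ) / 6) := by
  rw [Real.sqrt_eq_rpow, Real.mul_rpow hN (by positivity), ← Real.rpow_mul hq]
  norm_num

/-- A bound, linear in the constant of the weight, for all phase sums of length `N` whose phase has
logarithmic derivative with unit coefficient at `X ^ i`. -/
def LineBound (χ : DirichletCharacter ℂ (p ^ n)) (i : ℕ) (N E : ℝ) : Prop :=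
  ∀ (ψ : ZMod (p ^ n) → ZMod (p ^ n)) (G : (ZMod (p ^ n))[X]), LogDer ψ 1 G → IsUnit (G.coeff i) →
    ∀ (W : ℤ → ℝ) (A C : ℝ), SuppIn W A N → IsSmooth N C W → ‖phaseSum χ ψ W‖ ≤ E * C

/-- Here N/√q ≤ √q ≤ √(N q^(1/3)), so stationary phase alone suffices. The constant 68 is chosen to
agree with `lineBound_two`. -/
theorem lineBound_one {χ : DirichletCharacter ℂ (p ^ n)} (hχ : χ.IsPrimitive) {N : ℝ}
    (hN : 1 ≤ N) (h1 : ((p : ℝ) ^ n) ^ ((2 : ℝ) / 3) ≤ N) (h2 : N ≤ (p : ℝ) ^ n) :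
    LineBound χ 1 N (68 * p ^ 3 * (N ^ ((1 : ℝ) / 2) * ((p : ℝ) ^ n) ^ ((1 : ℝ) / 6))) := by
  intro ψ G hψ hG W A C hs hW
  have hC : 0 ≤ C := (abs_nonneg _).trans (hW.bound 0)
  have hp0 : (0 : ℝ) < p := by exact_mod_cast hp.out.pos
  have hψ' : LogDer ψ ((p : ZMod (p ^ n)) ^ 0 * 1) G := by simpa using hψ
  have h := norm_phaseSum_le hχ isUnit_one hψ' hG hN hs hW
  rw [pow_zero, div_one] at h
  set q := (p : ℝ) ^ n
  have hq : 0 < q := by positivity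
  rw [← sqrt_mul_rpow_one_third hq.le (by linarith)]
  set r := q ^ ((1 : ℝ) / 3) with hr
  have hr3 : r ^ 3 = q := rpow_one_third_pow hq.le
  have hr2 : r ^ 2 ≤ N := by
    rw [hr, ← Real.rpow_natCast, ← Real.rpow_mul hq.le]
    convert h1 using 2
    norm_num
  have hr0 : 0 < r := by positivity
  have hq2 : √q ≤ √(N * r) := Real.sqrt_le_sqrt (by rw [← hr3]; nlinarith)
  have hNq : N * √(1 / q) ≤ √q := by
    have : N * √(1 / q) ≤ q * √(1 / q) := by gcongr
    refine this.trans (le_of_eq ?_)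
    rw [Real.sqrt_div zero_le_one, Real.sqrt_one, mul_one_div, Real.div_sqrt]
  calc _ ≤ 16 * C * p ^ 3 * (√(N * r) + √(N * r)) := h.trans (by gcongr; exact hNq.trans hq2)
    _ = 32 * (C * p ^ 3 * √(N * r)) := by ring
    _ ≤ 68 * (C * p ^ 3 * √(N * r)) := by gcongr; norm_num
    _ = _ := by ring

theorem lineBound_two {χ : DirichletCharacter ℂ (p ^ n)} (hχ : χ.IsPrimitive) (hn : n ≠ 0)
    (hp3 : 3 < p) {N : ℝ} (hN : 1 ≤ N) (h1 : N ≤ ((p : ℝ) ^ n) ^ ((2 : ℝ) / 3)) :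
    LineBound χ 2 N (68 * p ^ 3 * (N ^ ((1 : ℝ) / 2) * ((p : ℝ) ^ n) ^ ((1 : ℝ) / 6))) := by
  intro ψ G hψ hG W A C hs hW
  have hC : 0 ≤ C := (abs_nonneg _).trans (hW.bound 0)
  have hp1 : (1 : ℝ) ≤ p := by exact_mod_cast hp.out.one_lt.le
  have hp0 : (0 : ℝ) < p := by linarith
  have hψ' : LogDer ψ ((p : ZMod (p ^ n)) ^ 0 * 1) G := by simpa using hψ
  have hq1 : (1 : ℝ) ≤ (p : ℝ) ^ n := one_le_pow₀ hp1
  -- The choice p^k ≈ q^(1/3) balances p^k and √(q/p^k) up to powers of p; N ≤ q^(2/3) keeps N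
  -- √(p^k/q) below q^(1/3).
  obtain ⟨k, hk1, hk2⟩ := exists_pow_near_prime p
    (Real.one_le_rpow hq1 (by norm_num : (0 : ℝ) ≤ 1 / 3))
  have h := norm_phaseSum_sq_le hχ hn hp3 isUnit_one hψ' hG hN hs hW k
  rw [zero_add] at h
  set q := (p : ℝ) ^ n
  have hq : 0 < q := by positivity
  rw [← sqrt_mul_rpow_one_third hq.le (by linarith)]
  set r := q ^ ((1 : ℝ) / 3) with hr
  have hr3 : r ^ 3 = q := rpow_one_third_pow hq.le
  have hr2 : N ≤ r ^ 2 := by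
    rw [hr, ← Real.rpow_natCast, ← Real.rpow_mul hq.le]
    convert h1 using 2
    norm_num
  have hr0 : 0 < r := by positivity
  have hP0 : (0 : ℝ) < (p : ℝ) ^ k := by positivity
  have hA : √(q / (p : ℝ) ^ k) ≤ p * r := by
    rw [Real.sqrt_le_left (by positivity), div_le_iff₀ hP0, ← hr3]
    calc r ^ 3 = r ^ 2 * r := by ring
      _ ≤ r ^ 2 * (p ^ k * p) := by gcongr
      _ ≤ r ^ 2 * (p ^ k * (p * p)) := by gcongr; exact le_mul_of_one_le_left hp0.le hp1
      _ = _ := by ring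
  have hB : √((p : ℝ) ^ k / q) ≤ 1 / r := by
    rw [Real.sqrt_le_left (by positivity), div_le_iff₀ hq, ← hr3]
    calc (p : ℝ) ^ k ≤ r := hk1
      _ = _ := by field_simp
  have hB' : N * √((p : ℝ) ^ k / q) ≤ r := by
    calc _ ≤ r ^ 2 * (1 / r) := by gcongr
      _ = r := by field_simp
  refine abs_le_of_sq_le_sq' ?_ (by positivity) |>.2
  have hsq : √(N * r) ^ 2 = N * r := Real.sq_sqrt (by positivity)
  calc _ ≤ 1536 * C ^ 2 * p ^ 4 * N * (p * r + p * r + p * r) := h.trans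
        (mul_le_mul_of_nonneg_left (add_le_add
          (add_le_add (hk1.trans (le_mul_of_one_le_left hr0.le hp1)) hA)
          (hB'.trans (le_mul_of_one_le_left hr0.le hp1))) (by positivity))
    _ = 4608 * (C ^ 2 * p ^ 5 * (N * r)) := by ring
    _ ≤ 68 ^ 2 * (C ^ 2 * p ^ 6 * (N * r)) := by
        gcongr
        · norm_num
        · norm_num
    _ = _ := by rw [mul_pow, mul_pow, mul_pow, hsq]; ring

theorem lineBound_three {χ : DirichletCharacter ℂ (p ^ n)} (hχ : χ.IsPrimitive) (hn : n ≠ 0)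
    (hp3 : 3 < p) {N : ℝ} (hN : 1 ≤ N) (h1 : N ≤ ((p : ℝ) ^ n) ^ ((4 : ℝ) / 9)) :
    LineBound χ 3 N (107 * p ^ 3 * (N ^ ((5 : ℝ) / 7) * ((p : ℝ) ^ n) ^ ((1 : ℝ) / 14))) := by
  intro ψ G hψ hG W A C hs hW
  have hC : 0 ≤ C := (abs_nonneg _).trans (hW.bound 0)
  have hp1 : (1 : ℝ) ≤ p := by exact_mod_cast hp.out.one_lt.le
  have hp0 : (0 : ℝ) < p := by linarith
  have hψ' : LogDer ψ ((p : ZMod (p ^ n)) ^ 0 * 1) G := by simpa using hψ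
  have hq1 : (1 : ℝ) ≤ (p : ℝ) ^ n := one_le_pow₀ hp1
  have hN0 : 0 < N := by linarith
  have hL := fun k₁ k₂ => norm_phaseSum_sq_le' hχ hn hp3 isUnit_one hψ' hG hN hs hW k₁ k₂
  set q := (p : ℝ) ^ n
  have hq : 0 < q := by positivity
  set s := q ^ ((1 : ℝ) / 7) with hs'
  set t := N ^ ((1 : ℝ) / 7) with ht
  have hs7 : s ^ 7 = q := rpow_one_seventh_pow hq.le
  have ht7 : t ^ 7 = N := rpow_one_seventh_pow hN0.le
  have hs1 : 1 ≤ s := Real.one_le_rpow hq1 (by norm_num)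
  have ht1 : 1 ≤ t := Real.one_le_rpow hN (by norm_num)
  have hs0 : 0 < s := by linarith
  have ht0 : 0 < t := by linarith
  have hts : t ^ 9 ≤ s ^ 4 := by
    have e1 : t ^ 9 = N ^ ((9 : ℝ) / 7) := by
      rw [ht, ← Real.rpow_natCast, ← Real.rpow_mul hN0.le]; norm_num
    have e2 : s ^ 4 = (q ^ ((4 : ℝ) / 9)) ^ ((9 : ℝ) / 7) := by
      rw [hs', ← Real.rpow_natCast, ← Real.rpow_mul hq.le, ← Real.rpow_mul hq.le]; norm_num
    rw [e1, e2]
    exact Real.rpow_le_rpow hN0.le h1 (by norm_num)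
  have hts' : t ≤ s ^ 2 := by
    by_contra! hlt
    have h3 : (s ^ 2) ^ 9 < t ^ 9 := by gcongr
    have h4 : s ^ 4 ≤ (s ^ 2) ^ 9 := by
      rw [← pow_mul]; exact pow_le_pow_right₀ hs1 (by norm_num)
    linarith
  -- With P₁ ≈ t³s and P₂ ≈ s²/t one has √(q/(P₁P₂)) ≈ P₂ and √(N P₂) ≈ P₁ up to powers of p. The
  -- remaining term t⁸/s² is at most s²/t exactly when t⁹ ≤ s⁴, that is N ≤ q^(4/9). The result is
  -- √(N t³ s) = t⁵ √s.
  obtain ⟨k₁, a1, a2⟩ := exists_pow_near_prime p (y := t ^ 3 * s)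
    (one_le_mul_of_one_le_of_one_le (one_le_pow₀ ht1) hs1)
  obtain ⟨k₂, b1, b2⟩ := exists_pow_near_prime p (y := s ^ 2 / t) ((one_le_div ht0).2 hts')
  have h := hL k₁ k₂
  rw [zero_add, pow_add] at h
  set P₁ := (p : ℝ) ^ k₁
  set P₂ := (p : ℝ) ^ k₂
  have hP₁ : 0 < P₁ := by positivity
  have hP₂ : 0 < P₂ := by positivity
  have c1 : P₁ * P₂ ≤ t ^ 2 * s ^ 3 := by
    calc _ ≤ t ^ 3 * s * (s ^ 2 / t) := by gcongr
      _ = _ := by field_simp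
  have c2 : t ^ 2 * s ^ 3 ≤ P₁ * P₂ * p ^ 2 := by
    calc t ^ 2 * s ^ 3 = t ^ 3 * s * (s ^ 2 / t) := by field_simp
      _ ≤ (P₁ * p) * (P₂ * p) := by gcongr
      _ = _ := by ring
  have hA : √(q / (P₁ * P₂)) ≤ p * (s ^ 2 / t) := by
    rw [Real.sqrt_le_left (by positivity), div_le_iff₀ (by positivity), ← hs7]
    calc s ^ 7 = s ^ 4 / t ^ 2 * (t ^ 2 * s ^ 3) := by field_simp
      _ ≤ s ^ 4 / t ^ 2 * (P₁ * P₂ * p ^ 2) := by gcongr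
      _ = _ := by field_simp
  have hB : √(P₁ * P₂ / q) ≤ t / s ^ 2 := by
    rw [Real.sqrt_le_left (by positivity), div_le_iff₀ hq, ← hs7]
    refine c1.trans (le_of_eq ?_)
    field_simp
  have hB' : N * √(P₁ * P₂ / q) ≤ s ^ 2 / t := by
    calc _ ≤ t ^ 7 * (t / s ^ 2) := by rw [ht7]; gcongr
      _ = t ^ 9 / (t * s ^ 2) := by field_simp
      _ ≤ s ^ 4 / (t * s ^ 2) := by gcongr
      _ = _ := by field_simp
  have hst : 0 < s ^ 2 / t := by positivity
  have hY : √(N * (P₂ + √(q / (P₁ * P₂)) + N * √(P₁ * P₂ / q))) ≤ 2 * p * (t ^ 3 * s) := by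
    rw [Real.sqrt_le_left (by positivity)]
    calc _ ≤ N * (p * (s ^ 2 / t) + p * (s ^ 2 / t) + p * (s ^ 2 / t)) := by
          exact mul_le_mul_of_nonneg_left (add_le_add
            (add_le_add (b1.trans (le_mul_of_one_le_left hst.le hp1)) hA)
            (hB'.trans (le_mul_of_one_le_left hst.le hp1))) hN0.le
      _ = 3 * p * (t ^ 6 * s ^ 2) := by rw [← ht7]; field_simp; ring
      _ ≤ 4 * p ^ 2 * (t ^ 6 * s ^ 2) := by
          gcongr
          · norm_num
          · exact le_self_pow₀ hp1 (by norm_num)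
      _ = _ := by ring
  have hgoal : N ^ ((5 : ℝ) / 7) * q ^ ((1 : ℝ) / 14) = t ^ 5 * √s := by
    rw [Real.sqrt_eq_rpow, ht, hs', ← Real.rpow_natCast, ← Real.rpow_mul hN0.le,
      ← Real.rpow_mul hq.le]
    norm_num
  rw [hgoal]
  refine abs_le_of_sq_le_sq' ?_ (by positivity) |>.2
  have hsq : √s ^ 2 = s := Real.sq_sqrt hs0.le
  calc _ ≤ 3768 * C ^ 2 * p ^ 3 * N * (p * (t ^ 3 * s) + 2 * p * (t ^ 3 * s)) := h.trans (by
        gcongr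
        exact a1.trans (le_mul_of_one_le_left (by positivity) hp1))
    _ = 11304 * (C ^ 2 * p ^ 4 * (t ^ 10 * s)) := by rw [← ht7]; ring
    _ ≤ 107 ^ 2 * (C ^ 2 * p ^ 6 * (t ^ 10 * s)) := by
        gcongr
        · norm_num
        · norm_num
    _ = _ := by rw [mul_pow, mul_pow, mul_pow, mul_pow, hsq]; ring

/-- The quadratic form `a x ^ 2 + 2 b x y + c y ^ 2`. -/
def quadForm {R : Type*} [CommRing R] (a b c x y : R) : R := a * x ^ 2 + 2 * b * x * y + c * y ^ 2

/-- Through each residue class modulo `p` on which the form is a unit there is a direction `(e, 1)`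
along which the character sums of length `N` are at most `E C`. -/
def GoodLines (χ : DirichletCharacter ℂ (p ^ n)) (a b c : ZMod (p ^ n)) (N E : ℝ) : Prop :=
  ∀ x₀ y₀ : ℤ, IsUnit (quadForm a b c x₀ y₀) → ∃ e : ℤ, |e| ≤ 2 ∧ ∀ r : ℤ, ∀ (W : ℤ → ℝ) (A C : ℝ),
    SuppIn W A N → IsSmooth N C W →
    ‖phaseSum χ (fun t => quadForm a b c (x₀ + p * r + e * t) (y₀ + t)) W‖ ≤ E * C

theorem red_two (hn : n ≠ 0) : red hn (2 : ZMod (p ^ n)) = 2 := map_ofNat _ 2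

theorem red_three (hn : n ≠ 0) : red hn (3 : ZMod (p ^ n)) = 3 := map_ofNat _ 3

theorem red_four (hn : n ≠ 0) : red hn (4 : ZMod (p ^ n)) = 4 := map_ofNat _ 4

theorem red_eight (hn : n ≠ 0) : red hn (8 : ZMod (p ^ n)) = 8 := map_ofNat _ 8

/-- The condition on e involves α, β, γ only modulo p, so one direction serves all the parallel
lines through x₀ + pr. -/
theorem goodLines_of_lineBound {χ : DirichletCharacter ℂ (p ^ n)} (hn : n ≠ 0)
    {a b c : ZMod (p ^ n)} {N E : ℝ} {i : ℕ} (hline : LineBound χ i N E)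
    (F : ZMod p → ZMod p → ZMod p → ZMod p)
    (hdir : ∀ a b c x y : ZMod p, x * (a * x + b * y) + y * (b * x + c * y) ≠ 0 →
      ∃ e : ℤ, |e| ≤ 2 ∧ F (x * (a * x + b * y) + y * (b * x + c * y))
        (e * (a * x + b * y) + (b * x + c * y)) (a * e ^ 2 + 2 * b * e + c) ≠ 0)
    (hF : ∀ α β γ : ZMod (p ^ n), IsUnit α → F (red hn α) (red hn β) (red hn γ) ≠ 0 →
      ∃ G : (ZMod (p ^ n))[X], LogDer (fun x => α + 2 * β * x + γ * x ^ 2) 1 G ∧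
        IsUnit (G.coeff i)) : GoodLines χ a b c N E := by
  intro x₀ y₀ hu
  have hq : ∀ x y : ZMod (p ^ n), quadForm a b c x y =
      x * (a * x + b * y) + y * (b * x + c * y) := fun x y => by unfold quadForm; ring
  have hu' := (isUnit_iff_red_ne_zero hn _).1 hu
  rw [hq] at hu'
  simp only [map_add, map_mul, map_intCast] at hu'
  obtain ⟨e, he, hFe⟩ := hdir _ _ _ _ _ hu'
  refine ⟨e, he, fun r W A C hs hW => ?_⟩
  obtain ⟨G, hG1, hG2⟩ := hF (quadForm a b c (x₀ + p * r) y₀)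
    (e * (a * (x₀ + p * r) + b * y₀) + (b * (x₀ + p * r) + c * y₀)) (a * e ^ 2 + 2 * b * e + c)
    (by
      rw [isUnit_iff_red_ne_zero hn, hq]
      simpa using hu')
    (by
      rw [hq]
      simpa [red_two] using hFe)
  have e1 : (fun t : ZMod (p ^ n) => quadForm a b c (x₀ + p * r + e * t) (y₀ + t)) =
      fun x => quadForm a b c (x₀ + p * r) y₀ +
        2 * (e * (a * (x₀ + p * r) + b * y₀) + (b * (x₀ + p * r) + c * y₀)) * x +
        (a * e ^ 2 + 2 * b * e + c) * x ^ 2 := by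
    funext t
    unfold quadForm
    ring
  rw [e1]
  exact hline _ G hG1 hG2 W A C hs hW

theorem natCast_ne_zero_zmod {a : ℕ} (ha : 0 < a) (hap : a < p) : (a : ZMod p) ≠ 0 := by
  rw [Ne, ZMod.natCast_eq_zero_iff]
  exact fun h => absurd (Nat.le_of_dvd ha h) (not_le.2 hap)

theorem goodLines_one {χ : DirichletCharacter ℂ (p ^ n)} (hn : 4 ≤ n) (hp3 : 3 < p)
    (a b c : ZMod (p ^ n)) {N E : ℝ} (hline : LineBound χ 1 N E) : GoodLines χ a b c N E := by
  have hn0 : n ≠ 0 := by omega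
  have h2 : (2 : ZMod p) ≠ 0 := by exact_mod_cast natCast_ne_zero_zmod (a := 2) two_pos (by omega)
  refine goodLines_of_lineBound hn0 hline (fun α β γ => 2 * β ^ 2 - γ * α)
    (fun a b c x y h => exists_direction₀ h2 a b c x y h) fun α β γ hα hf => ?_
  obtain ⟨G, hG, h1, -, -⟩ := exists_logDer_quadratic hn hα β γ
  refine ⟨G, hG, isUnit_of_mul_isUnit_right (x := α ^ 2) ?_⟩
  rw [h1, isUnit_iff_red_ne_zero hn0]
  have := mul_ne_zero (neg_ne_zero.2 h2) hf
  simpa [red_two, red_three, red_four, red_eight] using this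

theorem goodLines_two {χ : DirichletCharacter ℂ (p ^ n)} (hn : 4 ≤ n) (hp3 : 3 < p)
    (a b c : ZMod (p ^ n)) {N E : ℝ} (hline : LineBound χ 2 N E) : GoodLines χ a b c N E := by
  have hn0 : n ≠ 0 := by omega
  have h2 : (2 : ZMod p) ≠ 0 := by exact_mod_cast natCast_ne_zero_zmod (a := 2) two_pos (by omega)
  have h3 : (3 : ZMod p) ≠ 0 := by exact_mod_cast natCast_ne_zero_zmod (a := 3) three_pos hp3
  refine goodLines_of_lineBound hn0 hline (fun α β γ => β * (4 * β ^ 2 - 3 * γ * α))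
    (fun a b c x y h => exists_direction₁ h2 h3 a b c x y h) fun α β γ hα hf => ?_
  obtain ⟨G, hG, -, h1, -⟩ := exists_logDer_quadratic hn hα β γ
  refine ⟨G, hG, isUnit_of_mul_isUnit_right (x := α ^ 3) ?_⟩
  rw [h1, isUnit_iff_red_ne_zero hn0]
  have := mul_ne_zero h2 hf
  simpa [red_two, red_three, red_four, red_eight] using this

theorem goodLines_three {χ : DirichletCharacter ℂ (p ^ n)} (hn : 4 ≤ n) (hp3 : 3 < p)
    (a b c : ZMod (p ^ n)) {N E : ℝ} (hline : LineBound χ 3 N E) : GoodLines χ a b c N E := by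
  have hn0 : n ≠ 0 := by omega
  have h2 : (2 : ZMod p) ≠ 0 := by exact_mod_cast natCast_ne_zero_zmod (a := 2) two_pos (by omega)
  have h3 : (3 : ZMod p) ≠ 0 := by exact_mod_cast natCast_ne_zero_zmod (a := 3) three_pos hp3
  refine goodLines_of_lineBound hn0 hline
    (fun α β γ => 8 * β ^ 4 - 8 * β ^ 2 * γ * α + γ ^ 2 * α ^ 2)
    (fun a b c x y h => exists_direction₂ h2 h3 a b c x y h) fun α β γ hα hf => ?_
  obtain ⟨G, hG, -, -, h1⟩ := exists_logDer_quadratic hn hα β γ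
  refine ⟨G, hG, isUnit_of_mul_isUnit_right (x := α ^ 4) ?_⟩
  rw [h1, isUnit_iff_red_ne_zero hn0]
  have := mul_ne_zero (neg_ne_zero.2 h2) hf
  simpa [red_two, red_three, red_four, red_eight] using this

end BoxSum

/-! ### From lines to boxes -/

namespace BoxSum
open Finset

/-- `Φ` and its first and second differences are bounded like those of a function with two bounded
derivatives. -/
structure HasSmoothBound (C : ℝ) (Φ : ℝ → ℝ) : Prop where
  bound : ∀ x, |Φ x| ≤ C
  diff : ∀ x h, |Φ (x + h) - Φ x| ≤ C * |h|
  diff₂ : ∀ x h, |Φ (x + h) - 2 * Φ x + Φ (x - h)| ≤ C * h ^ 2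

theorem HasSmoothBound.mono {C C' : ℝ} {Φ : ℝ → ℝ} (h : HasSmoothBound C Φ) (hC : C ≤ C') :
    HasSmoothBound C' Φ :=
  ⟨fun x => (h.bound x).trans hC, fun x t => (h.diff x t).trans (by gcongr),
    fun x t => (h.diff₂ x t).trans (by gcongr)⟩

theorem exists_abs_le_schwartz (Φ : 𝓢(ℝ, ℝ)) : ∃ C, ∀ x, |Φ x| ≤ C := by
  obtain ⟨C, -, hC⟩ := Φ.decay 0 0
  exact ⟨C, fun x => by simpa using hC x⟩

theorem abs_sub_le_of_abs_deriv_le {f : ℝ → ℝ} (hf : Differentiable ℝ f) {C : ℝ}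
    (hC : ∀ x, |deriv f x| ≤ C) (x y : ℝ) : |f x - f y| ≤ C * |x - y| := by
  have := convex_univ.norm_image_sub_le_of_norm_deriv_le (f := f) (C := C) (x := y) (y := x)
    (fun z _ => hf z) (fun z _ => hC z) (Set.mem_univ _) (Set.mem_univ _)
  simpa using this

/-- The second difference is a first difference of y ↦ Φ(y + h) - Φ(y), whose derivative is at most
C₂|h|; the mean value theorem is used twice. -/
theorem exists_hasSmoothBound (Φ : 𝓢(ℝ, ℝ)) : ∃ C, HasSmoothBound C Φ := by
  obtain ⟨C₀, h₀⟩ := exists_abs_le_schwartz Φ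
  obtain ⟨C₁, h₁⟩ := exists_abs_le_schwartz (SchwartzMap.derivCLM ℝ ℝ Φ)
  obtain ⟨C₂, h₂⟩ := exists_abs_le_schwartz (SchwartzMap.derivCLM ℝ ℝ (SchwartzMap.derivCLM ℝ ℝ Φ))
  have d0 : Differentiable ℝ Φ := Φ.differentiable
  have d1 : Differentiable ℝ (SchwartzMap.derivCLM ℝ ℝ Φ) := (SchwartzMap.derivCLM ℝ ℝ Φ).differentiable
  have e1 : ∀ x y, |Φ x - Φ y| ≤ C₁ * |x - y| := abs_sub_le_of_abs_deriv_le d0 h₁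
  have e2 : ∀ x y, |deriv Φ x - deriv Φ y| ≤ C₂ * |x - y| := abs_sub_le_of_abs_deriv_le d1 h₂
  refine ⟨max C₀ (max C₁ C₂), fun x => (h₀ x).trans (le_max_left _ _), fun x h => ?_, fun x h => ?_⟩
  · refine (e1 (x + h) x).trans ?_
    rw [add_sub_cancel_left]
    gcongr
    exact (le_max_left _ _).trans (le_max_right _ _)
  · have hd : Differentiable ℝ fun y => Φ (y + h) - Φ y := by fun_prop
    have hd' : ∀ y, |deriv (fun y => Φ (y + h) - Φ y) y| ≤ C₂ * |h| := by
      intro y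
      rw [deriv_fun_sub (by fun_prop) (by fun_prop), deriv_comp_add_const]
      simpa using e2 (y + h) y
    have h3 := abs_sub_le_of_abs_deriv_le hd hd' x (x - h)
    simp only [sub_add_cancel, sub_sub_cancel] at h3
    rw [show Φ (x + h) - 2 * Φ x + Φ (x - h) = Φ (x + h) - Φ x - (Φ x - Φ (x - h)) by ring]
    refine h3.trans ?_
    rw [mul_assoc, abs_mul_abs_self, ← sq]
    gcongr
    exact (le_max_right _ _).trans (le_max_right _ _)

/-- Restriction of a smooth function to an arithmetic progression. -/
theorem HasSmoothBound.isSmooth {C : ℝ} {Φ : ℝ → ℝ} (h : HasSmoothBound C Φ) {N : ℝ} (hN : 0 < N)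
    {l : ℝ} (hl : 1 ≤ l) {u : ℝ} (hu : |u| ≤ l / N) (w : ℝ) :
    IsSmooth N (l ^ 2 * C) (fun s : ℤ => Φ (u * s + w)) := by
  have hC : 0 ≤ C := (abs_nonneg _).trans (h.bound 0)
  have hl2 : l ≤ l ^ 2 := le_self_pow₀ hl (by norm_num)
  refine ⟨fun t => (h.bound _).trans ?_, fun t d => ?_, fun t d => ?_⟩
  · exact le_mul_of_one_le_left hC (hl.trans hl2)
  · have := h.diff (u * t + w) (u * d)
    push_cast
    rw [show u * ((t : ℝ) + d) + w = u * t + w + u * d by ring]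
    refine this.trans ?_
    rw [abs_mul]
    calc C * (|u| * |(d : ℝ)|) ≤ C * (l ^ 2 / N * |(d : ℝ)|) := by
          gcongr
          exact hu.trans (by gcongr)
      _ = _ := by ring
  · have := h.diff₂ (u * t + w) (u * d)
    push_cast
    rw [show u * ((t : ℝ) + d) + w = u * t + w + u * d by ring,
      show u * ((t : ℝ) - d) + w = u * t + w - u * d by ring]
    refine this.trans ?_
    rw [mul_pow, ← sq_abs u]
    calc C * (|u| ^ 2 * (d : ℝ) ^ 2) ≤ C * ((l / N) ^ 2 * (d : ℝ) ^ 2) := by gcongr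
      _ = _ := by rw [div_pow]; ring

theorem tsum_eq_sum_classes {f : ℤ × ℤ → ℂ} (hf : Summable f) (N : ℕ) [NeZero N] :
    ∑' x, ∑' y, f (x, y) = ∑ x₀ : Fin N, ∑ y₀ : Fin N, ∑' i : ℤ, ∑' s : ℤ,
      f (i * N + (x₀ : ℕ), s * N + (y₀ : ℕ)) := by
  have hN : (N : ℤ) ≠ 0 := by exact_mod_cast NeZero.ne N
  rw [tsum_int_eq_sum_fin hf.prod N]
  refine sum_congr rfl fun x₀ _ => ?_
  have h1 : ∀ i : ℤ, ∑' y, f (i * N + (x₀ : ℕ), y) =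
      ∑ y₀ : Fin N, ∑' s : ℤ, f (i * N + (x₀ : ℕ), s * N + (y₀ : ℕ)) := fun i =>
    tsum_int_eq_sum_fin (hf.prod_factor _) N
  simp_rw [h1]
  refine Summable.tsum_finsetSum fun y₀ _ => ?_
  have : Summable fun x : ℤ × ℤ => f (x.1 * N + (x₀ : ℕ), x.2 * N + (y₀ : ℕ)) := by
    refine hf.comp_injective (i := fun x : ℤ × ℤ => (x.1 * N + ((x₀ : ℕ) : ℤ), x.2 * N + ((y₀ : ℕ) : ℤ))) ?_
    intro x y h
    simp only [Prod.mk.injEq, add_left_inj, mul_left_inj' hN] at h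
    exact Prod.ext h.1 h.2
  exact this.prod

/-- The shear `(r, s) ↦ (r + e s, s)`. -/
def shear (e : ℤ) : ℤ × ℤ ≃ ℤ × ℤ where
  toFun x := (x.1 + e * x.2, x.2)
  invFun x := (x.1 - e * x.2, x.2)
  left_inv x := by simp
  right_inv x := by simp

theorem tsum_shear {f : ℤ × ℤ → ℂ} (hf : Summable f) (e : ℤ) :
    ∑' i, ∑' s, f (i, s) = ∑' r, ∑' s, f (r + e * s, s) := by
  have h : Summable fun x : ℤ × ℤ => f (x.1 + e * x.2, x.2) := (shear e).summable_iff.2 hf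
  rw [← hf.tsum_prod, ← h.tsum_prod]
  exact ((shear e).tsum_eq f).symm

variable {p n : ℕ} [hp : Fact p.Prime]

/-- The sum of `χ` over the values of the quadratic form on a smoothed box. -/
noncomputable def boxSum (χ : DirichletCharacter ℂ (p ^ n)) (a b c : ZMod (p ^ n)) (Ψ Φ : ℝ → ℝ)
    (A B M N : ℝ) : ℂ :=
  ∑' x : ℤ, ∑' y : ℤ, (Ψ (((x : ℝ) - A) / M) : ℂ) * (Φ (((y : ℝ) - B) / N) : ℂ) *
    χ (quadForm a b c x y)

theorem abs_sub_le_of_weight_ne_zero {Φ : ℝ → ℝ} (hΦ : ∀ x, Φ x ≠ 0 → |x| ≤ 1) {N B y : ℝ}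
    (hN : 0 < N) (h : Φ ((y - B) / N) ≠ 0) : |y - B| ≤ N := by
  have := hΦ _ h
  rwa [abs_div, abs_of_pos hN, div_le_one hN] at this

theorem summable_box {Ψ Φ : ℝ → ℝ} (hΨs : ∀ x, Ψ x ≠ 0 → |x| ≤ 1) (hΦs : ∀ x, Φ x ≠ 0 → |x| ≤ 1)
    {A B M N : ℝ} (hM : 0 < M) (hN : 0 < N) (g : ℤ × ℤ → ℂ) :
    Summable fun z : ℤ × ℤ => (Ψ (((z.1 : ℝ) - A) / M) : ℂ) * (Φ (((z.2 : ℝ) - B) / N) : ℂ) * g z := by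
  refine summable_of_ne_finset_zero
    (s := Icc ⌈A - M⌉ ⌊A + M⌋ ×ˢ Icc ⌈B - N⌉ ⌊B + N⌋) fun z hz => ?_
  by_contra hne
  have h1 := left_ne_zero_of_mul hne
  have hx := abs_sub_le_of_weight_ne_zero hΨs hM (Complex.ofReal_ne_zero.1 (left_ne_zero_of_mul h1))
  have hy := abs_sub_le_of_weight_ne_zero hΦs hN (Complex.ofReal_ne_zero.1 (right_ne_zero_of_mul h1))
  rw [abs_le] at hx hy
  exact hz (mem_product.2 ⟨mem_Icc.2 ⟨Int.ceil_le.2 (by linarith), Int.le_floor.2 (by linarith)⟩,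
    mem_Icc.2 ⟨Int.ceil_le.2 (by linarith), Int.le_floor.2 (by linarith)⟩⟩)

/-- There are p² classes. In each, at most 7M sheared lines meet the box, and each carries a product
weight with constant 4(4p²C)² = 64 C² p⁴; this gives 448 C² p⁶. -/
theorem norm_boxSum_le {χ : DirichletCharacter ℂ (p ^ n)} (hn : n ≠ 0) {a b c : ZMod (p ^ n)}
    {M N E : ℝ} (hN : 1 ≤ N) (hNM : N ≤ M) (hE : 0 ≤ E) (hlines : GoodLines χ a b c N E)
    {Ψ Φ : ℝ → ℝ} {C : ℝ} (hΨ : HasSmoothBound C Ψ) (hΦ : HasSmoothBound C Φ)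
    (hΨs : ∀ x, Ψ x ≠ 0 → |x| ≤ 1) (hΦs : ∀ x, Φ x ≠ 0 → |x| ≤ 1) (A B : ℝ) :
    ‖boxSum χ a b c Ψ Φ A B M N‖ ≤ 448 * C ^ 2 * p ^ 6 * (M * E) := by
  have hN0 : 0 < N := by linarith
  have hM0 : 0 < M := by linarith
  have hp2 : (2 : ℝ) ≤ p := by exact_mod_cast hp.out.two_le
  have hp0 : (0 : ℝ) < p := by linarith
  have : NeZero p := ⟨hp.out.ne_zero⟩
  have hsum := summable_box hΨs hΦs (A := A) (B := B) hM0 hN0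
    (fun z : ℤ × ℤ => χ (quadForm a b c (z.1 : ZMod (p ^ n)) (z.2 : ZMod (p ^ n))))
  rw [boxSum, tsum_eq_sum_classes hsum p]
  have hclass : ∀ x₀ y₀ : Fin p, ‖∑' i : ℤ, ∑' s : ℤ,
      (Ψ ((((i * p + ((x₀ : ℕ) : ℤ) : ℤ) : ℝ) - A) / M) : ℂ) *
      (Φ ((((s * p + ((y₀ : ℕ) : ℤ) : ℤ) : ℝ) - B) / N) : ℂ) *
      χ (quadForm a b c ((i * p + ((x₀ : ℕ) : ℤ) : ℤ) : ZMod (p ^ n))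
        ((s * p + ((y₀ : ℕ) : ℤ) : ℤ) : ZMod (p ^ n)))‖ ≤ 448 * C ^ 2 * p ^ 4 * (M * E) := by
    intro x₀ y₀
    have hC0 : 0 ≤ 448 * C ^ 2 * p ^ 4 * (M * E) := by positivity
    by_cases hu : IsUnit (quadForm a b c (((x₀ : ℕ) : ℤ) : ZMod (p ^ n)) (((y₀ : ℕ) : ℤ) : ZMod (p ^ n)))
    swap
    · have hz : ∀ i s : ℤ, χ (quadForm a b c ((i * p + ((x₀ : ℕ) : ℤ) : ℤ) : ZMod (p ^ n))
          ((s * p + ((y₀ : ℕ) : ℤ) : ℤ) : ZMod (p ^ n))) = 0 := by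
        intro i s
        refine χ.map_nonunit fun h => hu ?_
        rw [isUnit_iff_red_ne_zero hn] at h ⊢
        simpa [quadForm] using h
      simp only [hz, mul_zero, tsum_zero, norm_zero]
      exact hC0
    obtain ⟨e, he, hline⟩ := hlines _ _ hu
    have he' : |(e : ℝ)| ≤ 2 := by exact_mod_cast he
    have hpz : (p : ℤ) ≠ 0 := by exact_mod_cast hp.out.ne_zero
    rw [tsum_shear (f := fun z : ℤ × ℤ => (Ψ ((((z.1 * p + ((x₀ : ℕ) : ℤ) : ℤ) : ℝ) - A) / M) : ℂ) *
      (Φ ((((z.2 * p + ((y₀ : ℕ) : ℤ) : ℤ) : ℝ) - B) / N) : ℂ) *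
      χ (quadForm a b c ((z.1 * p + ((x₀ : ℕ) : ℤ) : ℤ) : ZMod (p ^ n))
        ((z.2 * p + ((y₀ : ℕ) : ℤ) : ℤ) : ZMod (p ^ n)))) ?_ e]
    · set I : ℤ → ℂ := fun r => ∑' s : ℤ,
        (Ψ (((((r + e * s) * p + ((x₀ : ℕ) : ℤ) : ℤ) : ℝ) - A) / M) : ℂ) *
        (Φ ((((s * p + ((y₀ : ℕ) : ℤ) : ℤ) : ℝ) - B) / N) : ℂ) *
        χ (quadForm a b c (((r + e * s) * p + ((x₀ : ℕ) : ℤ) : ℤ) : ZMod (p ^ n))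
          ((s * p + ((y₀ : ℕ) : ℤ) : ℤ) : ZMod (p ^ n))) with hI
      have hsupp : ∀ r s : ℤ, Ψ (((((r + e * s) * p + ((x₀ : ℕ) : ℤ) : ℤ) : ℝ) - A) / M) ≠ 0 →
          Φ ((((s * p + ((y₀ : ℕ) : ℤ) : ℤ) : ℝ) - B) / N) ≠ 0 →
          |(r : ℝ) - (A - (x₀ : ℕ) - e * (B - (y₀ : ℕ))) / p| ≤ 3 * M := by
        intro r s h1 h2
        have h3 := abs_sub_le_of_weight_ne_zero hΨs hM0 h1
        have h4 := abs_sub_le_of_weight_ne_zero hΦs hN0 h2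
        push_cast at h3 h4
        have e1 : (r : ℝ) - (A - (x₀ : ℕ) - e * (B - (y₀ : ℕ))) / p =
            (((r + e * s) * p + (x₀ : ℕ) - A) - e * (s * p + (y₀ : ℕ) - B)) / p := by
          field_simp
          ring
        rw [e1, abs_div, abs_of_pos hp0, div_le_iff₀ hp0]
        have h5 := abs_sub (((r : ℝ) + e * s) * p + (x₀ : ℕ) - A) (e * (s * p + (y₀ : ℕ) - B))
        rw [abs_mul] at h5
        have h6 : |(e : ℝ)| * |(s : ℝ) * p + (y₀ : ℕ) - B| ≤ 2 * N :=
          mul_le_mul he' h4 (abs_nonneg _) (by norm_num)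
        nlinarith
      have hIs : SuppIn I ((A - (x₀ : ℕ) - e * (B - (y₀ : ℕ))) / p - 3 * M) (6 * M) := by
        intro r hr
        obtain ⟨s, hs⟩ : ∃ s : ℤ,
            (Ψ (((((r + e * s) * p + ((x₀ : ℕ) : ℤ) : ℤ) : ℝ) - A) / M) : ℂ) *
            (Φ ((((s * p + ((y₀ : ℕ) : ℤ) : ℤ) : ℝ) - B) / N) : ℂ) *
            χ (quadForm a b c (((r + e * s) * p + ((x₀ : ℕ) : ℤ) : ℤ) : ZMod (p ^ n))
              ((s * p + ((y₀ : ℕ) : ℤ) : ℤ) : ZMod (p ^ n))) ≠ 0 := by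
          by_contra! hcon
          exact hr (by simp only [hI, hcon, tsum_zero])
        have h1 := left_ne_zero_of_mul hs
        have h2 := hsupp r s (Complex.ofReal_ne_zero.1 (left_ne_zero_of_mul h1))
          (Complex.ofReal_ne_zero.1 (right_ne_zero_of_mul h1))
        rw [abs_le] at h2
        constructor <;> linarith
      have hIb : ∀ r, ‖I r‖ ≤ E * (64 * C ^ 2 * p ^ 4) := by
        intro r
        -- Along the line the first weight has slope ep/M, at most 2p/N in size because N ≤ M. This
        -- is why the lines have the shorter length.
        have s1 : IsSmooth N ((2 * (p : ℝ)) ^ 2 * C)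
            (fun s : ℤ => Ψ (((((r + e * s) * p + ((x₀ : ℕ) : ℤ) : ℤ) : ℝ) - A) / M)) := by
          have := hΨ.isSmooth hN0 (l := 2 * p) (by linarith) (u := e * p / M) ?_
            ((r * p + (x₀ : ℕ) - A) / M)
          · convert this using 3
            push_cast
            ring
          · rw [abs_div, abs_mul, abs_of_pos hp0, abs_of_pos hM0]
            gcongr
        have s2 : IsSmooth N ((2 * (p : ℝ)) ^ 2 * C)
            (fun s : ℤ => Φ ((((s * p + ((y₀ : ℕ) : ℤ) : ℤ) : ℝ) - B) / N)) := by
          have := hΦ.isSmooth hN0 (l := 2 * p) (by linarith) (u := p / N) ?_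
            (((y₀ : ℕ) - B) / N)
          · convert this using 3
            push_cast
            ring
          · rw [abs_div, abs_of_pos hp0, abs_of_pos hN0]
            gcongr
            linarith
        have h := hline r _ ((B - (y₀ : ℕ) - N) / p) _ ?_ (s1.mul hN0 s2)
        · refine le_trans (le_of_eq ?_) (h.trans (le_of_eq (by ring)))
          rw [hI, phaseSum]
          congr 1
          refine tsum_congr fun s => ?_
          push_cast
          congr 3 <;> ring
        · intro s hs
          have h4 := abs_sub_le_of_weight_ne_zero hΦs hN0 (right_ne_zero_of_mul hs)
          push_cast at h4
          rw [abs_le] at h4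
          constructor
          · rw [div_le_iff₀ hp0]; linarith
          · have : (s : ℝ) ≤ (B - (y₀ : ℕ) - N) / p + 2 * N / p := by
              rw [← add_div, le_div_iff₀ hp0]; linarith
            have h5 : 2 * N / p ≤ N := by
              rw [div_le_iff₀ hp0]; nlinarith
            linarith
      refine (hIs.norm_tsum_le (by linarith) hIb).trans ?_
      calc (6 * M + 1) * (E * (64 * C ^ 2 * p ^ 4)) ≤ (7 * M) * (E * (64 * C ^ 2 * p ^ 4)) := by
            gcongr
            linarith
        _ = _ := by ring
    · refine hsum.comp_injective
        (i := fun x : ℤ × ℤ => (x.1 * p + ((x₀ : ℕ) : ℤ), x.2 * p + ((y₀ : ℕ) : ℤ))) ?_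
      intro x y h
      simp only [Prod.mk.injEq, add_left_inj, mul_left_inj' hpz] at h
      exact Prod.ext h.1 h.2
  calc _ ≤ ∑ x₀ : Fin p, ∑ y₀ : Fin p, 448 * C ^ 2 * (p : ℝ) ^ 4 * (M * E) :=
        (norm_sum_le _ _).trans (sum_le_sum fun x₀ _ => (norm_sum_le _ _).trans
          (sum_le_sum fun y₀ _ => hclass x₀ y₀))
    _ = _ := by simp; ring

theorem boxSum_swap (χ : DirichletCharacter ℂ (p ^ n)) (a b c : ZMod (p ^ n)) {Ψ Φ : ℝ → ℝ}
    (hΨs : ∀ x, Ψ x ≠ 0 → |x| ≤ 1) (hΦs : ∀ x, Φ x ≠ 0 → |x| ≤ 1) (A B : ℝ) {M N : ℝ}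
    (hM : 0 < M) (hN : 0 < N) : boxSum χ a b c Ψ Φ A B M N = boxSum χ c b a Φ Ψ B A N M := by
  have hsum := summable_box hΨs hΦs (A := A) (B := B) hM hN
    (fun z : ℤ × ℤ => χ (quadForm a b c (z.1 : ZMod (p ^ n)) (z.2 : ZMod (p ^ n))))
  have hcomm := Summable.tsum_comm (f := fun x y : ℤ => (Ψ (((x : ℝ) - A) / M) : ℂ) *
    (Φ (((y : ℝ) - B) / N) : ℂ) * χ (quadForm a b c (x : ZMod (p ^ n)) y)) hsum
  refine hcomm.symm.trans ?_
  rw [boxSum]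
  refine tsum_congr fun y => tsum_congr fun x => ?_
  have : quadForm a b c (x : ZMod (p ^ n)) y = quadForm c b a (y : ZMod (p ^ n)) x := by
    unfold quadForm; ring
  rw [this, mul_comm (Ψ _ : ℂ)]

/-- The bound over a box from bounds along lines of the shorter length. -/
theorem norm_boxSum_le_add {χ : DirichletCharacter ℂ (p ^ n)} (hn : n ≠ 0) {a b c : ZMod (p ^ n)}
    {M N : ℝ} (hM : 1 ≤ M) (hN : 1 ≤ N) {E : ℝ → ℝ} (hEM : 0 ≤ E M) (hEN : 0 ≤ E N)
    (hlM : GoodLines χ c b a M (E M)) (hlN : GoodLines χ a b c N (E N))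
    {Ψ Φ : ℝ → ℝ} {C : ℝ} (hΨ : HasSmoothBound C Ψ) (hΦ : HasSmoothBound C Φ)
    (hΨs : ∀ x, Ψ x ≠ 0 → |x| ≤ 1) (hΦs : ∀ x, Φ x ≠ 0 → |x| ≤ 1) (A B : ℝ) :
    ‖boxSum χ a b c Ψ Φ A B M N‖ ≤ 448 * C ^ 2 * p ^ 6 * (M * E N + N * E M) := by
  rcases le_total N M with h | h
  · refine (norm_boxSum_le hn hN h hEN hlN hΨ hΦ hΨs hΦs A B).trans ?_
    gcongr
    exact le_add_of_nonneg_right (by positivity)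
  · rw [boxSum_swap χ a b c hΨs hΦs A B (by linarith) (by linarith)]
    refine (norm_boxSum_le hn hM h hEM hlM hΦ hΨ hΦs hΨs B A).trans ?_
    gcongr
    exact le_add_of_nonneg_left (by positivity)

end BoxSum

/-! ### Conclusion for the quadratic form -/

namespace BoxSum
open Finset

variable {p n : ℕ} [hp : Fact p.Prime]

theorem quadSum_eq_boxSum (χ : DirichletCharacter ℂ (p ^ n)) (a b c : ℤ_[p]) (Ψ Φ : ℝ → ℝ)
    (A B M N : ℝ) : quadSum p n χ a b c Ψ Φ A B M N =
      boxSum χ (PadicInt.toZModPow n a) (PadicInt.toZModPow n b) (PadicInt.toZModPow n c)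
        Ψ Φ A B M N := by
  refine tsum_congr fun x => tsum_congr fun y => ?_
  have h2 : PadicInt.toZModPow n (2 : ℤ_[p]) = 2 := map_ofNat _ 2
  simp only [quadForm, map_add, map_mul, map_pow, map_intCast, h2]

theorem GoodLines.mono {χ : DirichletCharacter ℂ (p ^ n)} {a b c : ZMod (p ^ n)} {N E E' : ℝ}
    (h : GoodLines χ a b c N E) (hE : E ≤ E') : GoodLines χ a b c N E' := by
  intro x₀ y₀ hu
  obtain ⟨e, he, hl⟩ := h x₀ y₀ hu
  refine ⟨e, he, fun r W A C hs hW => (hl r W A C hs hW).trans ?_⟩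
  have : 0 ≤ C := (abs_nonneg _).trans (hW.bound 0)
  gcongr

theorem goodLines_weyl {χ : DirichletCharacter ℂ (p ^ n)} (hχ : χ.IsPrimitive) (hn : 4 ≤ n)
    (hp3 : 3 < p) (a b c : ZMod (p ^ n)) {N : ℝ} (hN : 1 ≤ N) (hNq : N ≤ (p : ℝ) ^ n) :
    GoodLines χ a b c N (68 * p ^ 3 * (N ^ ((1 : ℝ) / 2) * ((p : ℝ) ^ n) ^ ((1 : ℝ) / 6))) := by
  rcases le_total N (((p : ℝ) ^ n) ^ ((2 : ℝ) / 3)) with h | h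
  · exact goodLines_two hn hp3 a b c (lineBound_two hχ (by omega) hp3 hN h)
  · exact goodLines_one hn hp3 a b c (lineBound_one hχ hN h hNq)

theorem goodLines_weyl_sq {χ : DirichletCharacter ℂ (p ^ n)} (hχ : χ.IsPrimitive) (hn : 4 ≤ n)
    (hp3 : 3 < p) (a b c : ZMod (p ^ n)) {N : ℝ} (hN : 1 ≤ N)
    (hNq : N ≤ ((p : ℝ) ^ n) ^ ((2 : ℝ) / 3)) :
    GoodLines χ a b c N (107 * p ^ 3 * (N ^ ((5 : ℝ) / 7) * ((p : ℝ) ^ n) ^ ((1 : ℝ) / 14))) := by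
  rcases le_total N (((p : ℝ) ^ n) ^ ((4 : ℝ) / 9)) with h | h
  · exact goodLines_three hn hp3 a b c (lineBound_three hχ (by omega) hp3 hN h)
  · refine (goodLines_two hn hp3 a b c (lineBound_two hχ (by omega) hp3 hN hNq)).mono ?_
    have hp0 : (0 : ℝ) < p := by exact_mod_cast hp.out.pos
    set q := (p : ℝ) ^ n
    have hq : 0 < q := by positivity
    have hN0 : 0 < N := by linarith
    -- The excess q^(1/6 - 1/14) is (q^(4/9))^(3/14), at most N^(3/14) = N^(5/7 - 1/2).
    have e1 : q ^ ((1 : ℝ) / 6) = (q ^ ((4 : ℝ) / 9)) ^ ((3 : ℝ) / 14) * q ^ ((1 : ℝ) / 14) := by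
      rw [← Real.rpow_mul hq.le, ← Real.rpow_add hq]; norm_num
    have e2 : N ^ ((5 : ℝ) / 7) = N ^ ((1 : ℝ) / 2) * N ^ ((3 : ℝ) / 14) := by
      rw [← Real.rpow_add hN0]; norm_num
    rw [e1, e2, mul_assoc (N ^ ((1 : ℝ) / 2))]
    gcongr
    norm_num

/-- Passing from 2 to j lowers the exponent of N by θ and raises that of q by 2θ, so N ≤ q² is what
is needed. -/
theorem rpow_mul_rpow_exponent_le {q N j : ℝ} (hq : 1 ≤ q) (hN : 1 ≤ N) (hNq : N ≤ q ^ (2 : ℝ))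
    (hj : 2 ≤ j) : N ^ ((5 : ℝ) / 7) * q ^ ((1 : ℝ) / 14) ≤
      N ^ ((7 * j - 4) / (2 * (5 * j - 3))) * q ^ ((j - 1) / (2 * (5 * j - 3))) := by
  have hq0 : 0 < q := by linarith
  have hN0 : 0 < N := by linarith
  have hj0 : 0 < 5 * j - 3 := by linarith
  set θ := (j - 2) / (14 * (5 * j - 3)) with hθ
  have hθ0 : 0 ≤ θ := div_nonneg (by linarith) (by positivity)
  have e1 : (5 : ℝ) / 7 = (7 * j - 4) / (2 * (5 * j - 3)) + θ := by
    rw [hθ]; field_simp; ring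
  have e2 : (j - 1) / (2 * (5 * j - 3)) = 2 * θ + 1 / 14 := by
    have hne := hj0.ne'
    have hd : (j - 2) / (14 * (5 * j - 3)) = (j - 2) / (5 * j - 3) / 14 := by
      rw [div_div, mul_comm]
    have hc := div_mul_cancel₀ (j - 2) hne
    rw [hθ, div_eq_iff (by positivity), hd]
    linear_combination -(2 / 7 : ℝ) * hc
  rw [e1, e2, Real.rpow_add hN0, Real.rpow_add hq0, mul_assoc, Real.rpow_mul hq0.le]
  gcongr

/-- The bound from one Weyl step. -/
theorem norm_quadSum_le {χ : DirichletCharacter ℂ (p ^ n)} (hχ : χ.IsPrimitive) (hn : 4 ≤ n)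
    (hp3 : 3 < p) (a b c : ℤ_[p]) {Ψ Φ : ℝ → ℝ} {C : ℝ} (hΨ : HasSmoothBound C Ψ)
    (hΦ : HasSmoothBound C Φ) (hΨs : ∀ x, Ψ x ≠ 0 → |x| ≤ 1) (hΦs : ∀ x, Φ x ≠ 0 → |x| ≤ 1)
    (A B : ℝ) {M N q j : ℝ} (hM : 1 ≤ M) (hN : 1 ≤ N) (hj : 2 ≤ j) (hq : q = (p : ℝ) ^ n)
    (hMq : M ≤ q ^ ((3 * j - 2) / (2 * (2 * j - 1))))
    (hNq : N ≤ q ^ ((3 * j - 2) / (2 * (2 * j - 1)))) :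
    ‖quadSum p n χ a b c Ψ Φ A B M N‖ ≤ (p : ℝ) ^ (9 : ℝ) * (50000 * C ^ 2) *
      ((M * N ^ ((1 : ℝ) / 2) + N * M ^ ((1 : ℝ) / 2)) * q ^ ((j - 1) / (2 * (2 * j - 1)))) := by
  have hp1 : (1 : ℝ) ≤ p := by exact_mod_cast hp.out.one_lt.le
  have hq1 : 1 ≤ q := hq ▸ one_le_pow₀ hp1
  have hj0 : 0 < 2 * j - 1 := by linarith
  have hexp : (3 * j - 2) / (2 * (2 * j - 1)) ≤ 1 := by
    rw [div_le_one (by positivity)]; linarith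
  have hle : q ^ ((3 * j - 2) / (2 * (2 * j - 1))) ≤ q := by
    simpa using Real.rpow_le_rpow_of_exponent_le hq1 hexp
  have hexp' : (1 : ℝ) / 6 ≤ (j - 1) / (2 * (2 * j - 1)) := by
    rw [div_le_div_iff₀ (by norm_num) (by positivity)]; linarith
  have hM' := hMq.trans hle
  have hN' := hNq.trans hle
  rw [quadSum_eq_boxSum]
  refine (norm_boxSum_le_add (by omega) hM hN
    (E := fun N => 68 * p ^ 3 * (N ^ ((1 : ℝ) / 2) * q ^ ((1 : ℝ) / 6)))
    (by positivity) (by positivity)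
    (by subst hq; exact goodLines_weyl hχ hn hp3 _ _ _ hM hM')
    (by subst hq; exact goodLines_weyl hχ hn hp3 _ _ _ hN hN') hΨ hΦ hΨs hΦs A B).trans ?_
  rw [show (p : ℝ) ^ (9 : ℝ) = (p : ℝ) ^ 9 by exact_mod_cast Real.rpow_natCast (p : ℝ) 9]
  calc _ = (p : ℝ) ^ 9 * (30464 * C ^ 2) *
        ((M * N ^ ((1 : ℝ) / 2) + N * M ^ ((1 : ℝ) / 2)) * q ^ ((1 : ℝ) / 6)) := by ring
    _ ≤ _ := by gcongr; norm_num

/-- The bound from two Weyl steps. -/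
theorem norm_quadSum_le' {χ : DirichletCharacter ℂ (p ^ n)} (hχ : χ.IsPrimitive) (hn : 4 ≤ n)
    (hp3 : 3 < p) (a b c : ℤ_[p]) {Ψ Φ : ℝ → ℝ} {C : ℝ} (hΨ : HasSmoothBound C Ψ)
    (hΦ : HasSmoothBound C Φ) (hΨs : ∀ x, Ψ x ≠ 0 → |x| ≤ 1) (hΦs : ∀ x, Φ x ≠ 0 → |x| ≤ 1)
    (A B : ℝ) {M N q j : ℝ} (hM : 1 ≤ M) (hN : 1 ≤ N) (hj : 2 ≤ j) (hq : q = (p : ℝ) ^ n)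
    (hMq : M ≤ q ^ ((2 : ℝ) / 3)) (hNq : N ≤ q ^ ((2 : ℝ) / 3)) :
    ‖quadSum p n χ a b c Ψ Φ A B M N‖ ≤ (p : ℝ) ^ (9 : ℝ) * (50000 * C ^ 2) *
      ((M * N ^ ((7 * j - 4) / (2 * (5 * j - 3))) + N * M ^ ((7 * j - 4) / (2 * (5 * j - 3)))) *
        q ^ ((j - 1) / (2 * (5 * j - 3)))) := by
  have hp1 : (1 : ℝ) ≤ p := by exact_mod_cast hp.out.one_lt.le
  have hq1 : 1 ≤ q := hq ▸ one_le_pow₀ hp1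
  have hle : q ^ ((2 : ℝ) / 3) ≤ q ^ (2 : ℝ) := Real.rpow_le_rpow_of_exponent_le hq1 (by norm_num)
  have hM' := rpow_mul_rpow_exponent_le hq1 hM (hMq.trans hle) hj
  have hN' := rpow_mul_rpow_exponent_le hq1 hN (hNq.trans hle) hj
  rw [quadSum_eq_boxSum]
  refine (norm_boxSum_le_add (by omega) hM hN
    (E := fun N => 107 * p ^ 3 * (N ^ ((5 : ℝ) / 7) * q ^ ((1 : ℝ) / 14)))
    (by positivity) (by positivity)
    (by subst hq; exact goodLines_weyl_sq hχ hn hp3 _ _ _ hM hMq)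
    (by subst hq; exact goodLines_weyl_sq hχ hn hp3 _ _ _ hN hNq) hΨ hΦ hΨs hΦs A B).trans ?_
  rw [show (p : ℝ) ^ (9 : ℝ) = (p : ℝ) ^ 9 by exact_mod_cast Real.rpow_natCast (p : ℝ) 9]
  calc _ = (p : ℝ) ^ 9 * (47936 * C ^ 2) *
        (M * (N ^ ((5 : ℝ) / 7) * q ^ ((1 : ℝ) / 14)) +
          N * (M ^ ((5 : ℝ) / 7) * q ^ ((1 : ℝ) / 14))) := by ring
    _ ≤ (p : ℝ) ^ 9 * (50000 * C ^ 2) *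
        (M * (N ^ ((7 * j - 4) / (2 * (5 * j - 3))) * q ^ ((j - 1) / (2 * (5 * j - 3)))) +
          N * (M ^ ((7 * j - 4) / (2 * (5 * j - 3))) * q ^ ((j - 1) / (2 * (5 * j - 3))))) := by
        gcongr
        norm_num
    _ = _ := by ring

theorem abs_le_one_of_isWeight {Φ : 𝓢(ℝ, ℝ)} (h : IsWeight Φ) (x : ℝ) (hx : Φ x ≠ 0) : |x| ≤ 1 :=
  abs_le.2 (h.2 (subset_tsupport _ hx))

end BoxSum

theorem mainTheorem1 :
    ∃ n₀ : ℕ, ∀ K₀ : ℝ, 0 < K₀ → ∃ K : ℝ, 0 < K ∧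
    ∀ Ψ Φ : 𝓢(ℝ, ℝ), IsWeight Ψ → IsWeight Φ →
    ∀ L₀ : ℝ, 0 < L₀ → ∃ L : ℝ, 0 < L ∧
    ∀ (p : ℕ) [Fact p.Prime], 3 < p →
    ∀ a b c : ℤ_[p], IsUnit (c * (a * c - b ^ 2)) →
    ∀ n : ℕ, 0 < n → n₀ ≤ n →
    ∀ χ : DirichletCharacter ℂ (p ^ n), χ.IsPrimitive →
    ∀ j₁ j₂ : ℕ, 2 ≤ j₁ → 2 ≤ j₂ →
    BoundT₁ p n χ Φ j₁ ((p : ℝ) ^ K₀ * L₀) → BoundT₁ p n χ Ψ j₁ ((p : ℝ) ^ K₀ * L₀) →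
    BoundT₂ p n χ Φ j₂ ((p : ℝ) ^ K₀ * L₀) → BoundT₂ p n χ Ψ j₂ ((p : ℝ) ^ K₀ * L₀) →
    ∀ q : ℝ, q = (p : ℝ) ^ n →
    (∀ A B M N : ℝ, 1 ≤ M → 1 ≤ N →
      ((q ^ (((j₁ : ℝ) - 1) / (2 * j₁ - 1)) ≤ M ∧
          M ≤ q ^ ((3 * (j₁ : ℝ) - 2) / (2 * (2 * j₁ - 1))) ∧
          q ^ (((j₁ : ℝ) - 1) / (2 * j₁ - 1)) ≤ N ∧
          N ≤ q ^ ((3 * (j₁ : ℝ) - 2) / (2 * (2 * j₁ - 1)))) →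
        ‖quadSum p n χ a b c Ψ Φ A B M N‖ ≤ (p : ℝ) ^ K * L *
          ((M * N ^ ((1 : ℝ) / 2) + N * M ^ ((1 : ℝ) / 2)) *
            q ^ (((j₁ : ℝ) - 1) / (2 * (2 * j₁ - 1))))) ∧
      ((q ^ (((j₂ : ℝ) - 1) / (3 * j₂ - 2)) ≤ M ∧ M ≤ q ^ ((2 : ℝ) / 3) ∧
          q ^ (((j₂ : ℝ) - 1) / (3 * j₂ - 2)) ≤ N ∧ N ≤ q ^ ((2 : ℝ) / 3)) →
        ‖quadSum p n χ a b c Ψ Φ A B M N‖ ≤ (p : ℝ) ^ K * L *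
          ((M * N ^ ((7 * (j₂ : ℝ) - 4) / (2 * (5 * j₂ - 3))) +
              N * M ^ ((7 * (j₂ : ℝ) - 4) / (2 * (5 * j₂ - 3)))) *
            q ^ (((j₂ : ℝ) - 1) / (2 * (5 * j₂ - 3)))))) ∧
    (∀ A B N : ℝ, 1 ≤ N →
      ((q ^ (((j₁ : ℝ) - 1) / (2 * j₁ - 1)) ≤ N ∧
          N ≤ q ^ ((3 * (j₁ : ℝ) - 2) / (2 * (2 * j₁ - 1)))) →
        ‖quadSum p n χ a b c Ψ Φ A B N N‖ ≤ (p : ℝ) ^ K * L *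
          (N ^ ((3 : ℝ) / 2) * q ^ (((j₁ : ℝ) - 1) / (2 * (2 * j₁ - 1))))) ∧
      ((q ^ (((j₂ : ℝ) - 1) / (3 * j₂ - 2)) ≤ N ∧ N ≤ q ^ ((2 : ℝ) / 3)) →
        ‖quadSum p n χ a b c Ψ Φ A B N N‖ ≤ (p : ℝ) ^ K * L *
          (N ^ ((17 * (j₂ : ℝ) - 10) / (2 * (5 * j₂ - 3))) *
            q ^ (((j₂ : ℝ) - 1) / (2 * (5 * j₂ - 3)))))) := by
  -- n₀ = 4 determines the coefficients of G up to degree 3. The exponent 9 is 6 from the box plus 3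
  -- from the line bounds.
  refine ⟨4, fun _ _ => ⟨9, by norm_num, fun Ψ Φ hΨ hΦ _ _ => ?_⟩⟩
  obtain ⟨C₁, h₁⟩ := BoxSum.exists_hasSmoothBound Ψ
  obtain ⟨C₂, h₂⟩ := BoxSum.exists_hasSmoothBound Φ
  have hΨ' := h₁.mono (le_max_left C₁ C₂)
  have hΦ' := h₂.mono (le_max_right C₁ C₂)
  set C := max C₁ C₂
  refine ⟨100000 * C ^ 2 + 1, by positivity, ?_⟩
  intro p hp hp3 a b c _ n _ hn χ hχ j₁ j₂ hj₁ hj₂ _ _ _ _ q hq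
  have hp0 : (0 : ℝ) < p := by exact_mod_cast hp.out.pos
  have hq0 : 0 < q := hq ▸ by positivity
  have hj₁' : (2 : ℝ) ≤ j₁ := by exact_mod_cast hj₁
  have hj₂' : (2 : ℝ) ≤ j₂ := by exact_mod_cast hj₂
  have hΨs := BoxSum.abs_le_one_of_isWeight hΨ
  have hΦs := BoxSum.abs_le_one_of_isWeight hΦ
  -- The factor 2 absorbs the two equal terms when M = N.
  have hL : ∀ {S T U : ℝ}, 0 ≤ U → T ≤ 2 * U → S ≤ (p : ℝ) ^ (9 : ℝ) * (50000 * C ^ 2) * T →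
      S ≤ (p : ℝ) ^ (9 : ℝ) * (100000 * C ^ 2 + 1) * U := by
    intro S T U hU hTU hS
    have hpK : (0 : ℝ) ≤ (p : ℝ) ^ (9 : ℝ) := by positivity
    calc S ≤ (p : ℝ) ^ (9 : ℝ) * (50000 * C ^ 2) * (2 * U) := hS.trans (by gcongr)
      _ = (p : ℝ) ^ (9 : ℝ) * (100000 * C ^ 2 * U) := by ring
      _ ≤ (p : ℝ) ^ (9 : ℝ) * ((100000 * C ^ 2 + 1) * U) := by
        gcongr
        linarith
      _ = _ := by ring
  refine ⟨fun A B M N hM hN => ⟨fun h => ?_, fun h => ?_⟩, fun A B N hN => ⟨fun h => ?_, fun h => ?_⟩⟩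
  · refine hL (by positivity) ?_ (BoxSum.norm_quadSum_le hχ hn hp3 a b c hΨ' hΦ' hΨs hΦs A B
      hM hN hj₁' hq h.2.1 h.2.2.2)
    have : 0 ≤ (M * N ^ ((1 : ℝ) / 2) + N * M ^ ((1 : ℝ) / 2)) *
      q ^ (((j₁ : ℝ) - 1) / (2 * (2 * j₁ - 1))) := by positivity
    linarith
  · refine hL (by positivity) ?_ (BoxSum.norm_quadSum_le' hχ hn hp3 a b c hΨ' hΦ' hΨs hΦs A B
      hM hN hj₂' hq h.2.1 h.2.2.2)
    have : 0 ≤ (M * N ^ ((7 * (j₂ : ℝ) - 4) / (2 * (5 * j₂ - 3))) +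
      N * M ^ ((7 * (j₂ : ℝ) - 4) / (2 * (5 * j₂ - 3)))) *
      q ^ (((j₂ : ℝ) - 1) / (2 * (5 * j₂ - 3))) := by positivity
    linarith
  · refine hL (by positivity) (le_of_eq ?_) (BoxSum.norm_quadSum_le hχ hn hp3 a b c hΨ' hΦ' hΨs hΦs
      A B hN hN hj₁' hq h.2 h.2)
    have hN0 : 0 < N := by linarith
    have e : N ^ ((3 : ℝ) / 2) = N * N ^ ((1 : ℝ) / 2) := by
      rw [← Real.rpow_one_add' hN0.le (by norm_num)]; norm_num
    rw [e]; ring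
  · refine hL (by positivity) (le_of_eq ?_) (BoxSum.norm_quadSum_le' hχ hn hp3 a b c hΨ' hΦ' hΨs hΦs
      A B hN hN hj₂' hq h.2 h.2)
    have hN0 : 0 < N := by linarith
    have hj : (5 * (j₂ : ℝ) - 3) ≠ 0 := by linarith
    have e : N ^ ((17 * (j₂ : ℝ) - 10) / (2 * (5 * j₂ - 3))) =
        N * N ^ ((7 * (j₂ : ℝ) - 4) / (2 * (5 * j₂ - 3))) := by
      have h0 : 0 < 5 * (j₂ : ℝ) - 3 := by linarith
      have h1 : 0 < 7 * (j₂ : ℝ) - 4 := by linarith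
      rw [← Real.rpow_one_add' hN0.le (by positivity), one_add_div (mul_ne_zero two_ne_zero hj)]
      ring_nf
    rw [e]; ring
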